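/- Let $(\mathcal A,\otimes,k)$ be a bicomplete abelian category with a closed symmetric monoidal structure, and let $\mathcal P$ be a reduced symmetric operad in $\mathcal A$ ($\mathcal P_0=0$, $\mathcal P_1=k$). Let $V=(V_1\xrightarrow{d}V_0)$ be a chain complex in $\mathcal A$ concentrated in degrees $1$ and $0$. Let $End^{\mathcal A}(V)_n$ be the object of $\mathcal A$ of chain maps $V^{\otimes n}\to V$ (the $0$-cycles of the internal Hom complex) and $End(X)_n=\underline{Hom}(X^{\otimes n},X)$ for $X\in\mathcal A$. Let $\partial:(V_1\oplus V_0)^{\otimes n}\to (V^{\otimes n})_1\oplus (V^{\otimes n})_0$ be the map which, on each summand of $(V_1\oplus V_0)^{\otimes n}$ given by a word in $V_1,V_0$, applies $d$ to all factors $V_1$ except the leftmost one and the identity to the other factors (so it is the identity on words with at most one letter $V_1$), and let $\rtimes: End^{\mathcal A}(V)_n\to End(V_1\oplus V_0)_n$ be $f\mapsto (f_1\oplus f_0)\circ\partial$. Let a $\mathcal P$-algebra structure on $V$ be given, i.e. chain maps $\mathcal P_n\otimes V^{\otimes n}\to V$ compatible with units, compositions and symmetric groups, with adjoints $\mathcal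 P_n\to End^{\mathcal A}(V)_n$. Then: (1) The composites $\mathcal P_n\to End^{\mathcal A}(V)_n\xrightarrow{\rtimes}End(V_1\oplus V_0)_n$ define a $\mathcal P$-algebra structure $\mu$ on $V_1\oplus V_0$, the degree $0$ part of the given structure is a $\mathcal P$-algebra structure on $V_0$, and $s=0\oplus \mathrm{Id}$, $t=d\oplus\mathrm{Id}:V_1\oplus V_0\rightrightarrows V_0$ and the inclusion $i_2:V_0\to V_1\oplus V_0$ are morphisms of $\mathcal P$-algebras with $s i_2=t i_2=\mathrm{Id}$. This reflexive graph is a $\mathrm{Cat}^1$-$\mathcal P$-algebra: with $E=V_1\oplus V_0$, for every $n\ge 2$ the composite $\mathcal P_n\otimes\ker s\otimes\ker t\otimes E^{\otimes n-2}\to\mathcal P_n\otimes E^{\otimes n}\xrightarrow{\mu}E$ is zero. (2) $V_1=\ker s$ carries a $\mathcal P$-algebra structure for which the inclusion $V_1\to V_1\oplus V_0$ is a morphism of $\mathcal P$-algebras, and the operations of $V_1\oplus V_0$ with at least one argument in $V_1$ and the others in $V_0$ or $V_1$ define an internal action $$\rho:\bigoplus_n\mathcal P_n\otimes_{\Sigma_n}\big((V_0\oplus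 V_1)^{\otimes n}/V_0^{\otimes n}\big)\to V_1$$ of $V_0$ on $V_1$ (a map that restricts to the structure map of $V_1$ and is associative). With these structures $d:V_1\to V_0$ is a crossed module of $\mathcal P$-algebras: $d$ is a morphism of $\mathcal P$-algebras, it is equivariant for $\rho$ and the natural action of $V_0$ on itself, and it satisfies the Peiffer identities, i.e. for all $n\ge i\ge 2$ the map $\rho$ on $\mathcal P_n\otimes V_1^{\otimes i}\otimes V_0^{\otimes n-i}$ equals its composite with $\mathrm{Id}\otimes\mathrm{Id}\otimes d^{\otimes i-1}\otimes\mathrm{Id}$, that is $$\rho(\gamma;x_1,\dots,x_i,b_{i+1},\dots,b_n)=\rho(\gamma;x_1,dx_2,\dots,dx_i,b_{i+1},\dots,b_n)$$ in element notation. -/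

import Mathlib

open CategoryTheory MonoidalCategory Limits

universe v u

noncomputable section

namespace OpAlg

attribute [local instance] Abelian.hasFiniteBiproducts

section Tensor

variable {C : Type u} [Category.{v} C] [MonoidalCategory C]

/-- The tensor product `X 0 ⊗ X 1 ⊗ ⋯ ⊗ X (n - 1)` of a finite family, bracketed from the left. -/
@[reducible]
def tprod : {n : ℕ} → (Fin n → C) → C
  | 0, _ => 𝟙_ C
  | n + 1, X => tprod (fun i : Fin n => X i.castSucc) ⊗ X (Fin.last n)

/-- The tensor product of a finite family of morphisms. -/
def tmap : {n : ℕ} → {X Y : Fin n → C} → (∀ i, X i ⟶ Y i) → (tprod X ⟶ tprod Y)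
  | 0, _, _, _ => 𝟙 (𝟙_ C)
  | n + 1, _, _, f => tmap (fun i : Fin n => f i.castSucc) ⊗ₘ f (Fin.last n)

/-- The tensor power `X^{⊗ n}`. -/
abbrev tpow (X : C) (n : ℕ) : C := tprod (fun _ : Fin n => X)

/-- The tensor power `f^{⊗ n}` of a morphism. -/
abbrev tpowMap {X Y : C} (f : X ⟶ Y) (n : ℕ) : tpow X n ⟶ tpow Y n := tmap (fun _ => f)

/-- The associativity isomorphism `X^{⊗ (a + b)} ≅ X^{⊗ a} ⊗ X^{⊗ b}`. -/
def tsplit (X : C) (a : ℕ) : (b : ℕ) → (tpow X (a + b) ≅ tpow X a ⊗ tpow X b)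
  | 0 => (ρ_ (tpow X a)).symm
  | b + 1 => whiskerRightIso (tsplit X a b) X ≪≫ α_ (tpow X a) (tpow X b) X

theorem tensorHom_whiskerRight_comm {W X W' X' Y Z : C} {g : W ⟶ X} {g' : W' ⟶ X'}
    {r : X ⟶ X'} {l : W ⟶ W'} (h : g ≫ r = l ≫ g') (f : Y ⟶ Z) :
    (g ⊗ₘ f) ≫ (r ▷ Z) = (l ▷ Y) ≫ (g' ⊗ₘ f) := by
  rw [MonoidalCategory.tensorHom_def, MonoidalCategory.tensorHom_def, Category.assoc, whisker_exchange,
    ← comp_whiskerRight_assoc, h, comp_whiskerRight_assoc]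

end Tensor

section Permutations

variable {C : Type u} [Category.{v} C] [MonoidalCategory C] [SymmetricCategory C]

/-- The symmetry of `X^{⊗ (n + 1)}` that moves the last factor to place `i` and keeps the order of
the other factors. -/
def moveLast (X : C) : (n : ℕ) → Fin (n + 1) → (tpow X (n + 1) ⟶ tpow X (n + 1))
  | 0, _ => 𝟙 _
  | n + 1, i =>
    if h : i = Fin.last (n + 1) then 𝟙 _
    else (α_ (tpow X n) X X).hom ≫ (tpow X n ◁ (β_ X X).hom) ≫ (α_ (tpow X n) X X).inv ≫
      (moveLast X n (i.castPred h) ▷ X)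

/-- The bijection `Fin n ≃ Fin m` obtained from `e : Fin (n + 1) ≃ Fin (m + 1)` by deleting the
last element of the source and its image, and renumbering in order. -/
def dropLast {n m : ℕ} (e : Fin (n + 1) ≃ Fin (m + 1)) : Fin n ≃ Fin m :=
  (finSuccAboveEquiv (Fin.last n)).trans
    ((e.subtypeEquiv (p := fun x => x ≠ Fin.last n) (q := fun y => y ≠ e (Fin.last n))
        (fun _ => not_congr e.injective.eq_iff.symm)).trans
      (finSuccAboveEquiv (e (Fin.last n))).symm)

/-- The symmetry of tensor powers that moves the factor at place `j` to place `e j`. For `n = m`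
this is the left action of the symmetric group on `X^{⊗ n}`. -/
def tperm (X : C) : {n m : ℕ} → (Fin n ≃ Fin m) → (tpow X n ⟶ tpow X m)
  | 0, 0, _ => 𝟙 _
  | _ + 1, m + 1, e => (tperm X (dropLast e) ▷ X) ≫ moveLast X m (e (Fin.last _))
  | 0, _ + 1, e => (e.symm 0).elim0
  | _ + 1, 0, e => (e 0).elim0

theorem tpowMap_moveLast {X Y : C} (f : X ⟶ Y) : ∀ (n : ℕ) (i : Fin (n + 1)),
    tpowMap f (n + 1) ≫ moveLast Y n i = moveLast X n i ≫ tpowMap f (n + 1)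
  | 0, _ => by simp [moveLast]
  | n + 1, i => by
    by_cases h : i = Fin.last (n + 1)
    · simp [moveLast, h]
    · have ih := tpowMap_moveLast f n (i.castPred h)
      rw [moveLast, moveLast, dif_neg h, dif_neg h]
      simp only [tmap] at ih ⊢
      simp only [Category.assoc]
      rw [← tensorHom_whiskerRight_comm ih f, associator_naturality_assoc,
        ← associator_inv_naturality_assoc]
      congr 1
      simp only [← id_tensorHom, tensorHom_comp_tensorHom_assoc, Category.id_comp,
        Category.comp_id, BraidedCategory.braiding_naturality]

theorem tpowMap_tperm {X Y : C} (f : X ⟶ Y) : ∀ {n m : ℕ} (e : Fin n ≃ Fin m),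
    tpowMap f n ≫ tperm Y e = tperm X e ≫ tpowMap f m
  | 0, 0, _ => by simp [tperm]
  | n + 1, m + 1, e => by
    have ih := tpowMap_tperm f (dropLast e)
    have h := tpowMap_moveLast f m (e (Fin.last n))
    simp only [tperm, Category.assoc]
    rw [← h]
    simp only [tmap] at ih ⊢
    rw [← Category.assoc, ← Category.assoc]
    congr 1
    exact tensorHom_whiskerRight_comm ih f
  | 0, _ + 1, e => (e.symm 0).elim0
  | _ + 1, 0, e => (e 0).elim0

/-- The morphism that feeds the `m` consecutive factors after the first `p` ones to `g`:
`z ⊗ (x₁, …, x_{p+m+q}) ↦ (x₁, …, x_p, g (z; x_{p+1}, …, x_{p+m}), x_{p+m+1}, …)`. -/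
def insertOp {X Z : C} {m : ℕ} (g : Z ⊗ tpow X m ⟶ X) (p q : ℕ) :
    Z ⊗ tpow X (p + m + q) ⟶ tpow X (p + 1 + q) :=
  (Z ◁ ((tsplit X (p + m) q).hom ≫ ((tsplit X p m).hom ▷ tpow X q))) ≫
    (α_ Z (tpow X p ⊗ tpow X m) (tpow X q)).inv ≫
    (((α_ Z (tpow X p) (tpow X m)).inv ≫ ((β_ Z (tpow X p)).hom ▷ tpow X m) ≫
      (α_ (tpow X p) Z (tpow X m)).hom ≫ (tpow X p ◁ g)) ▷ tpow X q) ≫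
    (tsplit X (p + 1) q).inv

end Permutations

section Operads

/-- The bijection that numbers the `p + m + q` inputs of a partial composite: `p` inputs on the
left, then the `m` inputs of the inserted operation, then `q` inputs on the right. -/
def slotEquiv (p m q : ℕ) : (Fin p ⊕ Fin q) ⊕ Fin m ≃ Fin (p + m + q) :=
  (Equiv.sumAssoc (Fin p) (Fin q) (Fin m)).trans
    (((Equiv.refl (Fin p)).sumCongr (Equiv.sumComm (Fin q) (Fin m))).trans
      ((Equiv.sumAssoc (Fin p) (Fin m) (Fin q)).symm.trans
        ((finSumFinEquiv.sumCongr (Equiv.refl (Fin q))).trans finSumFinEquiv)))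

/-- The bijection between the inputs of two partial composites given by a bijection `r` of the
outer inputs and a bijection `t` of the inner ones. -/
def slotPerm {p m q p' m' q' : ℕ} (r : Fin p ⊕ Fin q ≃ Fin p' ⊕ Fin q') (t : Fin m ≃ Fin m') :
    Fin (p + m + q) ≃ Fin (p' + m' + q') :=
  (slotEquiv p m q).symm.trans ((r.sumCongr t).trans (slotEquiv p' m' q'))

/-- Symmetric operads in a symmetric monoidal category, presented by partial compositions.
`act e` for `e : Fin n ≃ Fin n` is the right action of the permutation `e` on `obj n`; allowing
`e : Fin n ≃ Fin m` (so `n = m`) only serves to identify `obj n` and `obj m` when `n = m`.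
`circ p m q` is the partial composition `∘_{p+1}` of operations of arities `p + 1 + q` and `m`. -/
structure Operad (C : Type u) [Category.{v} C] [MonoidalCategory C] [SymmetricCategory C] where
  obj : ℕ → C
  act : ∀ {n m : ℕ}, (Fin n ≃ Fin m) → (obj m ⟶ obj n)
  one : 𝟙_ C ⟶ obj 1
  circ : ∀ p m q : ℕ, obj (p + 1 + q) ⊗ obj m ⟶ obj (p + m + q)
  act_refl : ∀ n : ℕ, act (Equiv.refl (Fin n)) = 𝟙 (obj n)
  act_trans : ∀ {n m l : ℕ} (e : Fin n ≃ Fin m) (e' : Fin m ≃ Fin l),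
    act (e.trans e') = act e' ≫ act e
  one_circ : ∀ m : ℕ,
    (one ▷ obj m) ≫ circ 0 m 0 ≫ act (finCongr (by omega : m = 0 + m + 0)) = (λ_ (obj m)).hom
  circ_one : ∀ p q : ℕ, (obj (p + 1 + q) ◁ one) ≫ circ p 1 q = (ρ_ (obj (p + 1 + q))).hom
  /-- `(x ∘ y) ∘ z = x ∘ (y ∘ z)` when `z` is inserted into an input of `y` -/
  circ_assoc : ∀ p q r s m : ℕ,
    (circ p (r + 1 + s) q ▷ obj m) ≫
        (act (finCongr (by omega : (p + r) + 1 + (s + q) = p + (r + 1 + s) + q)) ▷ obj m) ≫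
        circ (p + r) m (s + q) =
      (α_ (obj (p + 1 + q)) (obj (r + 1 + s)) (obj m)).hom ≫ (obj (p + 1 + q) ◁ circ r m s) ≫
        circ p (r + m + s) q ≫
        act (finCongr (by omega : (p + r) + m + (s + q) = p + (r + m + s) + q))
  /-- insertions of `y` and `z` into two different inputs of `x` commute -/
  circ_comm : ∀ p q r m n : ℕ,
    (act (finCongr (by omega : p + 1 + (q + 1 + r) = (p + 1 + q) + 1 + r)) ▷ obj m ▷ obj n) ≫
        (circ p m (q + 1 + r) ▷ obj n) ≫
        (act (finCongr (by omega : (p + m + q) + 1 + r = p + m + (q + 1 + r))) ▷ obj n) ≫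
        circ (p + m + q) n r =
      (α_ (obj ((p + 1 + q) + 1 + r)) (obj m) (obj n)).hom ≫
        (obj ((p + 1 + q) + 1 + r) ◁ (β_ (obj m) (obj n)).hom) ≫
        (α_ (obj ((p + 1 + q) + 1 + r)) (obj n) (obj m)).inv ≫
        (circ (p + 1 + q) n r ▷ obj m) ≫
        (act (finCongr (by omega : p + 1 + (q + n + r) = (p + 1 + q) + n + r)) ▷ obj m) ≫
        circ p m (q + n + r) ≫
        act (finCongr (by omega : (p + m + q) + n + r = p + m + (q + n + r)))
  /-- partial compositions are equivariant -/
  circ_act : ∀ {p m q p' m' q' : ℕ} (r : Fin p ⊕ Fin q ≃ Fin p' ⊕ Fin q') (t : Fin m ≃ Fin m'),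
    (act (slotPerm r (Equiv.refl (Fin 1))) ⊗ₘ act t) ≫ circ p m q =
      circ p' m' q' ≫ act (slotPerm r t)

variable {C : Type u} [Category.{v} C] [MonoidalCategory C] [SymmetricCategory C]

/-- An operad is reduced if `P(0) = 0` and `P(1)` is the monoidal unit. -/
def Operad.IsReduced (P : Operad C) : Prop := IsZero (P.obj 0) ∧ IsIso P.one

/-- The structure maps `μ n` respect the unit of the operad. -/
def UnitLaw (P : Operad C) {X : C} (μ : ∀ n, P.obj n ⊗ tpow X n ⟶ X) : Prop :=
  (P.one ▷ tpow X 1) ≫ μ 1 = (λ_ (tpow X 1)).hom ≫ (λ_ X).hom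

/-- The structure maps `μ n` respect the partial compositions of the operad. -/
def CompLaw (P : Operad C) {X : C} (μ : ∀ n, P.obj n ⊗ tpow X n ⟶ X) : Prop :=
  ∀ p m q : ℕ, (P.circ p m q ▷ tpow X (p + m + q)) ≫ μ (p + m + q) =
    (α_ (P.obj (p + 1 + q)) (P.obj m) (tpow X (p + m + q))).hom ≫
      (P.obj (p + 1 + q) ◁ insertOp (μ m) p q) ≫ μ (p + 1 + q)

/-- A structure of algebra over the operad `P` on the object `X`. -/
structure Alg (P : Operad C) (X : C) where
  μ : ∀ n : ℕ, P.obj n ⊗ tpow X n ⟶ X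
  unit : UnitLaw P μ
  comp : CompLaw P μ
  equivariant : ∀ {n m : ℕ} (e : Fin n ≃ Fin m),
    (P.act e ▷ tpow X n) ≫ μ n = (P.obj m ◁ tperm X e) ≫ μ m

/-- Morphisms of algebras over an operad. -/
def IsAlgHom {P : Operad C} {X Y : C} (a : Alg P X) (b : Alg P Y) (f : X ⟶ Y) : Prop :=
  ∀ n, (P.obj n ◁ tpowMap f n) ≫ b.μ n = a.μ n ≫ f

/-- The morphism from `P(n)` to the object `End(X)(n) = Hom(X^{⊗ n}, X)` of the endomorphism
operad that is adjoint to the structure map of an algebra. -/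
def Alg.toEnd [MonoidalClosed C] {P : Operad C} {X : C} (a : Alg P X) (n : ℕ) :
    P.obj n ⟶ (ihom (tpow X n)).obj X :=
  MonoidalClosed.curry ((β_ (tpow X n) (P.obj n)).hom ≫ a.μ n)

end Operads

section Words

variable {A : Type u} [Category.{v} A] [Abelian A]

/-- The object in degree `k` of a two-term graded object: `X` in degree `1`, `B` in degree `0`. -/
def pick (X B : A) : Fin 2 → A
  | 0 => B
  | 1 => X

/-- The inclusion of the degree `k` part in the total object `X ⊕ B`. -/
def inc (X B : A) : (k : Fin 2) → (pick X B k ⟶ X ⊞ B)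
  | 0 => biprod.inr
  | 1 => biprod.inl

/-- The projection of the total object `X ⊕ B` on the degree `k` part. -/
def prj (X B : A) : (k : Fin 2) → (X ⊞ B ⟶ pick X B k)
  | 0 => biprod.snd
  | 1 => biprod.fst

/-- The identity if `k = l`, the morphism `d` if `k = 1` and `l = 0`, zero if `k = 0` and
`l = 1`. -/
def step {X B : A} (d : X ⟶ B) : (k l : Fin 2) → (pick X B k ⟶ pick X B l)
  | 0, 0 => 𝟙 B
  | 1, 1 => 𝟙 X
  | 1, 0 => d
  | 0, 1 => 0

variable [MonoidalCategory A]

/-- The tensor product of copies of `X` and `B`, with `X` at the places where `w` is `1`. -/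
abbrev word (X B : A) {n : ℕ} (w : Fin n → Fin 2) : A := tprod (fun j => pick X B (w j))

/-- The inclusion of a summand of `(X ⊕ B)^{⊗ n}`. -/
abbrev wordInc (X B : A) {n : ℕ} (w : Fin n → Fin 2) : word X B w ⟶ tpow (X ⊞ B) n :=
  tmap (fun j => inc X B (w j))

/-- The projection on a summand of `(X ⊕ B)^{⊗ n}`. -/
abbrev wordPrj (X B : A) {n : ℕ} (w : Fin n → Fin 2) : tpow (X ⊞ B) n ⟶ word X B w :=
  tmap (fun j => prj X B (w j))

/-- If `w' ≤ w`, the morphism that applies `d` at the places where `w` is `1` and `w'` is `0`,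
and the identity elsewhere (the zero morphism otherwise). -/
abbrev wordStep {X B : A} (d : X ⟶ B) {n : ℕ} (w w' : Fin n → Fin 2) : word X B w ⟶ word X B w' :=
  tmap (fun j => step d (w j) (w' j))

/-- The words of length `n` and degree `k`. -/
abbrev Words (n k : ℕ) : Type := {w : Fin n → Fin 2 // ∑ i, (w i : ℕ) = k}

end Words

section TwoTerm

variable {A : Type u} [Category.{v} A] [Abelian A] [MonoidalCategory A]

/-- The degree `k` part of the tensor power `V^{⊗ n}` of the two-term complex
`V = (V₁ ⟶ V₀)`. -/
def cpow (V₁ V₀ : A) (n k : ℕ) : A := ⨁ (fun w : Words n k => word V₁ V₀ w.1)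

/-- If `w'` is obtained from `w` by replacing the entry `1` at a place `i` by `0`, the sign
`(-1)^(w 0 + ⋯ + w (i - 1))` of the Leibniz rule. -/
def leibnizSign {n : ℕ} (w w' : Fin n → Fin 2) : ℤ :=
  ∏ i, ∏ j, if j < i ∧ w i ≠ w' i then (-1) ^ (w j : ℕ) else 1

/-- The differential `(V^{⊗ n})_{k+1} ⟶ (V^{⊗ n})_k`. -/
def cpowD {V₁ V₀ : A} (d : V₁ ⟶ V₀) (n k : ℕ) : cpow V₁ V₀ n (k + 1) ⟶ cpow V₁ V₀ n k :=
  biproduct.matrix (fun (w : Words n (k + 1)) (w' : Words n k) =>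
    leibnizSign w.1 w'.1 • wordStep d w.1 w'.1)

/-- The projection of `(V₁ ⊕ V₀)^{⊗ n}` on its summand `(V^{⊗ n})_k`. -/
def cpowPrj (V₁ V₀ : A) (n k : ℕ) : tpow (V₁ ⊞ V₀) n ⟶ cpow V₁ V₀ n k :=
  biproduct.lift (fun w : Words n k => wordPrj V₁ V₀ w.1)

/-- The Koszul sign of a permutation of homogeneous factors of degrees `w 0, …, w (n - 1)`. -/
def koszulSign {n m : ℕ} (e : Fin n ≃ Fin m) (w : Fin n → Fin 2) : ℤ :=
  ∏ i, ∏ j, if i < j ∧ e j < e i then (-1) ^ ((w i : ℕ) * (w j : ℕ)) else 1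

/-- The symmetry of tensor powers of complexes that moves the factor at place `j` to place
`e j`, in degree `k`. -/
def cpowPerm [SymmetricCategory A] (V₁ V₀ : A) {n m : ℕ} (e : Fin n ≃ Fin m) (k : ℕ) :
    cpow V₁ V₀ n k ⟶ cpow V₁ V₀ m k :=
  biproduct.matrix (fun (w : Words n k) (w' : Words m k) =>
    koszulSign e w.1 • (wordInc V₁ V₀ w.1 ≫ tperm (V₁ ⊞ V₀) e ≫ wordPrj V₁ V₀ w'.1))

/-- The morphism on total objects `P ⊗ (V₁ ⊕ V₀)^{⊗ n} ⟶ V₁ ⊕ V₀` of the degree zero morphism of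
graded objects `P ⊗ V^{⊗ n} ⟶ V` with components `f₁` and `f₀`; it vanishes on
`(V^{⊗ n})_k` for `k ≥ 2`. -/
def totalMap {V₁ V₀ Z : A} {n : ℕ} (f₁ : Z ⊗ cpow V₁ V₀ n 1 ⟶ V₁) (f₀ : Z ⊗ cpow V₁ V₀ n 0 ⟶ V₀) :
    Z ⊗ tpow (V₁ ⊞ V₀) n ⟶ V₁ ⊞ V₀ :=
  biprod.lift ((Z ◁ cpowPrj V₁ V₀ n 1) ≫ f₁) ((Z ◁ cpowPrj V₁ V₀ n 0) ≫ f₀)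

/-- A structure of algebra over the operad `P` (of `A`, placed in degree zero) on the chain complex
`V = (d : V₁ ⟶ V₀)` concentrated in degrees `1` and `0`: morphisms of complexes
`P(n) ⊗ V^{⊗ n} ⟶ V`, with components `μ₁ n`, `μ₀ n` in degrees `1` and `0` (`V` is zero in
the other degrees), compatible with units, compositions and symmetries. -/
structure ComplexAlg [SymmetricCategory A] (P : Operad A) {V₁ V₀ : A} (d : V₁ ⟶ V₀) where
  μ₁ : ∀ n : ℕ, P.obj n ⊗ cpow V₁ V₀ n 1 ⟶ V₁
  μ₀ : ∀ n : ℕ, P.obj n ⊗ cpow V₁ V₀ n 0 ⟶ V₀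
  chain₁ : ∀ n, (P.obj n ◁ cpowD d n 0) ≫ μ₀ n = μ₁ n ≫ d
  chain₂ : ∀ n, (P.obj n ◁ cpowD d n 1) ≫ μ₁ n = 0
  unit : UnitLaw P (fun n => totalMap (μ₁ n) (μ₀ n))
  comp : CompLaw P (fun n => totalMap (μ₁ n) (μ₀ n))
  equivariant₁ : ∀ {n m : ℕ} (e : Fin n ≃ Fin m),
    (P.act e ▷ cpow V₁ V₀ n 1) ≫ μ₁ n = (P.obj m ◁ cpowPerm V₁ V₀ e 1) ≫ μ₁ m
  equivariant₀ : ∀ {n m : ℕ} (e : Fin n ≃ Fin m),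
    (P.act e ▷ cpow V₁ V₀ n 0) ≫ μ₀ n = (P.obj m ◁ cpowPerm V₁ V₀ e 0) ≫ μ₀ m

/-- The degree zero part of `μ`: the structure maps `P(n) ⊗ V₀^{⊗ n} ⟶ V₀`. -/
def ComplexAlg.base [SymmetricCategory A] {P : Operad A} {V₁ V₀ : A} {d : V₁ ⟶ V₀}
    (S : ComplexAlg P d) (n : ℕ) : P.obj n ⊗ tpow V₀ n ⟶ V₀ :=
  (P.obj n ◁ biproduct.ι (fun w : Words n 0 => word V₁ V₀ w.1) ⟨fun _ => 0, by simp⟩) ≫ S.μ₀ n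

variable [MonoidalClosed A]

/-- The differential from degree `0` to degree `-1` of the complex of internal morphisms
`Hom(V^{⊗ n}, V)`: it sends `(f₀, f₁)` to `(d ∘ f₁ - f₀ ∘ d, - f₁ ∘ d)`. -/
def homD {V₁ V₀ : A} (d : V₁ ⟶ V₀) (n : ℕ) :
    ((ihom (cpow V₁ V₀ n 1)).obj V₁ ⊞ (ihom (cpow V₁ V₀ n 0)).obj V₀) ⟶
      ((ihom (cpow V₁ V₀ n 1)).obj V₀ ⊞ (ihom (cpow V₁ V₀ n 2)).obj V₁) :=
  biprod.lift
    (biprod.fst ≫ (ihom (cpow V₁ V₀ n 1)).map d -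
      biprod.snd ≫ (MonoidalClosed.pre (cpowD d n 0)).app V₀)
    (-(biprod.fst ≫ (MonoidalClosed.pre (cpowD d n 1)).app V₁))

/-- The object `End^A(V)(n)` of morphisms of complexes `V^{⊗ n} ⟶ V`, that is the `0`-cycles of
the complex of internal morphisms. -/
def EndA {V₁ V₀ : A} (d : V₁ ⟶ V₀) (n : ℕ) : A := kernel (homD d n)

/-- The morphism `(ev₁, ev₀)`. -/
def EndA.ev {V₁ V₀ : A} (d : V₁ ⟶ V₀) (n : ℕ) : EndA d n ⟶
    (ihom (cpow V₁ V₀ n 1)).obj V₁ ⊞ (ihom (cpow V₁ V₀ n 0)).obj V₀ :=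
  kernel.ι (homD d n)

/-- The morphism `P(n) ⟶ End^A(V)(n)` adjoint to the structure maps of a `P`-algebra structure on
the complex `V`. -/
def ComplexAlg.toEndA [SymmetricCategory A] {P : Operad A} {V₁ V₀ : A} {d : V₁ ⟶ V₀}
    (S : ComplexAlg P d) (n : ℕ) : P.obj n ⟶ EndA d n :=
  kernel.lift (homD d n)
    (biprod.lift (MonoidalClosed.curry ((β_ (cpow V₁ V₀ n 1) (P.obj n)).hom ≫ S.μ₁ n))
      (MonoidalClosed.curry ((β_ (cpow V₁ V₀ n 0) (P.obj n)).hom ≫ S.μ₀ n)))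
    (by
      have h1 := S.chain₁ n
      have h2 := S.chain₂ n
      apply biprod.hom_ext
      · simp only [homD, Category.assoc, biprod.lift_fst, Preadditive.comp_sub,
          biprod.lift_fst_assoc, biprod.lift_snd_assoc, zero_comp]
        rw [sub_eq_zero, ← MonoidalClosed.curry_natural_right, MonoidalClosed.curry_pre_app]
        congr 1
        rw [Category.assoc, ← h1]
        simp
      · simp only [homD, Category.assoc, biprod.lift_snd, Preadditive.comp_neg,
          biprod.lift_fst_assoc, zero_comp]
        rw [MonoidalClosed.curry_pre_app, BraidedCategory.braiding_naturality_left_assoc, h2,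
          comp_zero, neg_eq_zero]
        apply MonoidalClosed.uncurry_injective
        rw [MonoidalClosed.uncurry_curry, MonoidalClosed.uncurry_eq]
        exact (((tensorLeft (cpow V₁ V₀ n 2)).map_zero _ _ |> congrArg
          (fun f => f ≫ (ihom.ev (cpow V₁ V₀ n 2)).app V₁)).trans zero_comp).symm)

/-- The word that keeps only the leftmost `1` of `w`. -/
def lead {n : ℕ} (w : Fin n → Fin 2) : Fin n → Fin 2 :=
  fun j => if w j = 1 ∧ ∀ i < j, w i = 0 then 1 else 0

/-- The morphism `(V₁ ⊕ V₀)^{⊗ n} ⟶ (V^{⊗ n})_1 ⊕ (V^{⊗ n})_0` that applies `d`, on each summand,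
to all factors `V₁` except the leftmost one (and so is the identity on the summands with at most
one factor `V₁`). -/
def partialMap {V₁ V₀ : A} (d : V₁ ⟶ V₀) (n : ℕ) :
    tpow (V₁ ⊞ V₀) n ⟶ cpow V₁ V₀ n 1 ⊞ cpow V₁ V₀ n 0 :=
  biprod.lift
    (biproduct.lift (fun w' : Words n 1 =>
      ∑ w : Fin n → Fin 2, if lead w = w'.1 then wordPrj V₁ V₀ w ≫ wordStep d w w'.1 else 0))
    (biproduct.lift (fun w' : Words n 0 =>
      ∑ w : Fin n → Fin 2, if lead w = w'.1 then wordPrj V₁ V₀ w ≫ wordStep d w w'.1 else 0))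

/-- The morphism `Hom(X₁, Y₁) ⊕ Hom(X₀, Y₀) ⟶ Hom(X₁ ⊕ X₀, Y₁ ⊕ Y₀)` of diagonal matrices. -/
def diagHom (X₁ X₀ Y₁ Y₀ : A) :
    ((ihom X₁).obj Y₁ ⊞ (ihom X₀).obj Y₀) ⟶ (ihom (X₁ ⊞ X₀)).obj (Y₁ ⊞ Y₀) :=
  biprod.desc
    ((MonoidalClosed.pre (biprod.fst : X₁ ⊞ X₀ ⟶ X₁)).app Y₁ ≫ (ihom (X₁ ⊞ X₀)).map biprod.inl)
    ((MonoidalClosed.pre (biprod.snd : X₁ ⊞ X₀ ⟶ X₀)).app Y₀ ≫ (ihom (X₁ ⊞ X₀)).map biprod.inr)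

/-- The morphism `⋊ : End^A(V)(n) ⟶ End(V₁ ⊕ V₀)(n)`. -/
def rtimes {V₁ V₀ : A} (d : V₁ ⟶ V₀) (n : ℕ) :
    EndA d n ⟶ (ihom (tpow (V₁ ⊞ V₀) n)).obj (V₁ ⊞ V₀) :=
  EndA.ev d n ≫ diagHom _ _ _ _ ≫ (MonoidalClosed.pre (partialMap d n)).app (V₁ ⊞ V₀)

end TwoTerm

section Cat1

variable {A : Type u} [Category.{v} A] [Abelian A] [MonoidalCategory A] [SymmetricCategory A]

/-- A reflexive graph `s, t : E ⇉ B`, `i : B ⟶ E` of algebras over `P`. -/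
structure IsReflexiveGraph {P : Operad A} {E B : A} (a : Alg P E) (b : Alg P B)
    (s t : E ⟶ B) (i : B ⟶ E) : Prop where
  hom_s : IsAlgHom a b s
  hom_t : IsAlgHom a b t
  hom_i : IsAlgHom b a i
  i_s : i ≫ s = 𝟙 B
  i_t : i ≫ t = 𝟙 B

/-- The family `ker s, ker t, E, …, E`. -/
def kerFamily {E B : A} (s t : E ⟶ B) (n : ℕ) : Fin (n + 2) → A :=
  Fin.cases (kernel s) (Fin.cases (kernel t) (fun _ => E))

/-- The inclusions of the members of the family `ker s, ker t, E, …, E` in `E`. -/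
def kerInc {E B : A} (s t : E ⟶ B) (n : ℕ) : ∀ j : Fin (n + 2), kerFamily s t n j ⟶ E :=
  Fin.cases (kernel.ι s) (Fin.cases (kernel.ι t) (fun _ => 𝟙 E))

/-- A `Cat¹`-algebra over `P`: a reflexive graph of algebras such that all operations of arity at
least two vanish on `ker s ⊗ ker t ⊗ E ⊗ ⋯ ⊗ E`. -/
structure IsCat1 {P : Operad A} {E B : A} (a : Alg P E) (b : Alg P B)
    (s t : E ⟶ B) (i : B ⟶ E) : Prop extends IsReflexiveGraph a b s t i where
  cat1 : ∀ n : ℕ, (P.obj (n + 2) ◁ tmap (kerInc s t n)) ≫ a.μ (n + 2) = 0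

end Cat1

section Actions

variable {A : Type u} [Category.{v} A] [Abelian A] [MonoidalCategory A] [SymmetricCategory A]

/-- The quotient `(X ⊕ B)^{⊗ n} / B^{⊗ n}`. -/
def relPow (X B : A) (n : ℕ) : A := cokernel (tpowMap (biprod.inr : B ⟶ X ⊞ B) n)

/-- The action of the symmetric group on `(X ⊕ B)^{⊗ n} / B^{⊗ n}`. -/
def relPerm (X B : A) {n : ℕ} (e : Equiv.Perm (Fin n)) : relPow X B n ⟶ relPow X B n :=
  cokernel.map _ _ (tperm B e) (tperm (X ⊞ B) e) (tpowMap_tperm _ e)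

/-- The coinvariants `P(n) ⊗_{Σ_n} ((X ⊕ B)^{⊗ n} / B^{⊗ n})`. -/
def relCoinv (P : Operad A) (X B : A) (n : ℕ) : A :=
  cokernel (biproduct.desc (fun e : Equiv.Perm (Fin n) =>
    (P.act e ▷ relPow X B n) - (P.obj n ◁ relPerm X B e)))

/-- The object `P ∘ (B | X) = ⨁ₙ P(n) ⊗_{Σ_n} ((X ⊕ B)^{⊗ n} / B^{⊗ n})`. -/
def relSchur [HasColimits A] (P : Operad A) (X B : A) : A := ∐ (relCoinv P X B)

/-- The canonical morphism `P(n) ⊗ (X ⊕ B)^{⊗ n} ⟶ P ∘ (B | X)`. -/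
def relSchur.of [HasColimits A] (P : Operad A) (X B : A) (n : ℕ) :
    P.obj n ⊗ tpow (X ⊞ B) n ⟶ relSchur P X B :=
  (P.obj n ◁ cokernel.π (tpowMap (biprod.inr : B ⟶ X ⊞ B) n)) ≫ cokernel.π _ ≫
    Sigma.ι (relCoinv P X B) n

/-- The map `P(n) ⊗ (X ⊕ B)^{⊗ n} ⟶ X ⊕ B` with components `r` and the structure map of `B`
(precomposed with the projection on `B^{⊗ n}`). -/
def semidirectMap {P : Operad A} {X B : A} (b : Alg P B) (n : ℕ)
    (r : P.obj n ⊗ tpow (X ⊞ B) n ⟶ X) : P.obj n ⊗ tpow (X ⊞ B) n ⟶ X ⊞ B :=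
  biprod.lift r ((P.obj n ◁ tpowMap (biprod.snd : X ⊞ B ⟶ B) n) ≫ b.μ n)

/-- An internal action of the algebra `B` on the algebra `X`: a morphism `ρ : P ∘ (B | X) ⟶ X`
that restricts to the structure map of `X` and is associative. -/
structure Action [HasColimits A] {P : Operad A} {X B : A} (x : Alg P X) (b : Alg P B) where
  ρ : relSchur P X B ⟶ X
  restrict : ∀ n : ℕ,
    (P.obj n ◁ tpowMap (biprod.inl : X ⟶ X ⊞ B) n) ≫ relSchur.of P X B n ≫ ρ = x.μ n
  assoc : ∀ p m q : ℕ,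
    (P.circ p m q ▷ tpow (X ⊞ B) (p + m + q)) ≫ relSchur.of P X B (p + m + q) ≫ ρ =
      (α_ (P.obj (p + 1 + q)) (P.obj m) (tpow (X ⊞ B) (p + m + q))).hom ≫
        (P.obj (p + 1 + q) ◁ insertOp (semidirectMap b m (relSchur.of P X B m ≫ ρ)) p q) ≫
        relSchur.of P X B (p + 1 + q) ≫ ρ

variable [HasColimits A]

/-- The restriction of an action to `P(n) ⊗ X^{(w)}`, where `X^{(w)}` is the tensor product of
copies of `X` and `B` with `X` at the places where `w` is `1`. -/
def Action.on {P : Operad A} {X B : A} {x : Alg P X} {b : Alg P B} (r : Action x b) {n : ℕ}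
    (w : Fin n → Fin 2) : P.obj n ⊗ word X B w ⟶ X :=
  (P.obj n ◁ wordInc X B w) ≫ relSchur.of P X B n ≫ r.ρ

/-- The action `r` of `B` on `X` is the one induced by an algebra `E`, an inclusion
`i : X ⟶ E` and a section `j : B ⟶ E`: the operations of `E` applied to elements of `X` and `B`
with at least one element of `X`. -/
def Action.IsInducedBy {P : Operad A} {X B E : A} {x : Alg P X} {b : Alg P B} (r : Action x b)
    (a : Alg P E) (i : X ⟶ E) (j : B ⟶ E) : Prop :=
  ∀ (n : ℕ) (w : Fin n → Fin 2), (∃ k, w k = 1) →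
    r.on w ≫ i = (P.obj n ◁ (wordInc X B w ≫ tpowMap (biprod.desc i j) n)) ≫ a.μ n

/-- A precrossed module: `d : X ⟶ B` is a morphism of algebras that is equivariant for the given
action of `B` on `X` and the natural action of `B` on itself. -/
structure IsPrecrossedModule {P : Operad A} {X B : A} {x : Alg P X} {b : Alg P B}
    (r : Action x b) (d : X ⟶ B) : Prop where
  hom : IsAlgHom x b d
  equivariant : ∀ (n : ℕ) (w : Fin n → Fin 2), (∃ k, w k = 1) →
    r.on w ≫ d = (P.obj n ◁ (wordInc X B w ≫ tpowMap (biprod.desc d (𝟙 B)) n)) ≫ b.μ n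

/-- The word `1 ⋯ 1 0 ⋯ 0` with `i` entries `1`. -/
def initialWord (n i : ℕ) : Fin n → Fin 2 := fun j => if (j : ℕ) < i then 1 else 0

/-- A crossed module: a precrossed module that satisfies the Peiffer identities
`ρ(γ; x₁, …, xᵢ, b_{i+1}, …, bₙ) = ρ(γ; x₁, d x₂, …, d xᵢ, b_{i+1}, …, bₙ)` for
`2 ≤ i ≤ n`. -/
structure IsCrossedModule {P : Operad A} {X B : A} {x : Alg P X} {b : Alg P B}
    (r : Action x b) (d : X ⟶ B) : Prop extends IsPrecrossedModule r d where
  peiffer : ∀ n i : ℕ, 2 ≤ i → i ≤ n →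
    r.on (initialWord n i) =
      (P.obj n ◁ wordStep d (initialWord n i) (initialWord n 1)) ≫ r.on (initialWord n 1)

end Actions

end OpAlg

end

/-! Write E = V₁ ⊕ V₀. The given structure yields maps `total` on E that use `μ₁` and `μ₀` on words
with one or no letter V₁ and vanish on all other words. They satisfy the operad laws, but longer
words carry no information. The required operations are `op` = `total` ∘ `fold`, where `fold`
applies d to every letter V₁ but the leftmost.

Composition. Let t(x, b) = dx + b, regarded as an endomorphism `target` of E, let π₀ = `baseProj`
and let π₁ be the projection on V₁. Sorting words by the place of the leftmost V₁ gives `fold` =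
π₀^{⊗n} + Σₖ π₀^{⊗k} ⊗ π₁ ⊗ t^{⊗(n-k-1)}. This expression splits over concatenation
(`leadSum_tsplit`). After `op`, each of t, π₁ and π₀ equals `total` preceded by t^{⊗n}, by the sum
over k, or by π₀^{⊗n} (`op_target`, `op_fst_inl`, `op_baseProj`). So folding commutes with insertion
up to exchanging `op` for `total` (`insertOp_fold`), and the composition law of `total` passes to
`op`. The statement about t is the chain condition from degree 1 to degree 0.

Symmetry. A permutation may change which V₁ is leftmost. The chain condition from degree 2 to degree
1 says that `μ₁` does not see which letter V₁ is spared when d is applied to the others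
(`wordStep_linear`), so `op` is equivariant although `fold` is not.

Consequences. On ker s ⊗ ker t ⊗ E ⊗ ⋯ each summand of `fold` contains π₀ on the first factor or t
on the second, hence vanishes: this is the Cat¹ condition. The action consists of the V₁-components
of `op`. Its equivariance is the fact that t is a morphism, and its Peiffer identities hold because
both sides fold to the same word. -/

noncomputable section

namespace OpAlg

attribute [local instance] Abelian.hasFiniteBiproducts

/-! ### Functoriality of tensor products of finite families. -/

section TensorFamilies

variable {C : Type u} [Category.{v} C] [MonoidalCategory C]

theorem tmap_comp : ∀ {n : ℕ} {X Y Z : Fin n → C} (f : ∀ i, X i ⟶ Y i) (g : ∀ i, Y i ⟶ Z i),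
    tmap f ≫ tmap g = tmap (fun i => f i ≫ g i)
  | 0, _, _, _, _, _ => by simp [tmap]
  | n + 1, _, _, _, f, g => by
    simp only [tmap, tensorHom_comp_tensorHom]
    rw [tmap_comp]

theorem tmap_id : ∀ {n : ℕ} (X : Fin n → C), tmap (fun i => 𝟙 (X i)) = 𝟙 (tprod X)
  | 0, _ => rfl
  | n + 1, X => by
    simp only [tmap]
    rw [tmap_id, id_tensorHom_id]

theorem tmap_tsplit {X Y : C} (a : ℕ) : ∀ (b : ℕ) (f : Fin (a + b) → (X ⟶ Y)),
    tmap f ≫ (tsplit Y a b).hom =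
      (tsplit X a b).hom ≫ (tmap (fun i => f (Fin.castAdd b i)) ⊗ₘ
        tmap (fun i => f (Fin.natAdd a i)))
  | 0, f => by
    simp only [tsplit, Iso.symm_hom, tmap]
    rw [tensorHom_id]
    exact (rightUnitor_inv_naturality _)
  | b + 1, f => by
    have ih := tmap_tsplit a b (fun i => f i.castSucc)
    simp only [tsplit, Iso.trans_hom, whiskerRightIso_hom]
    have e : tmap f = tmap (fun i : Fin (a + b) => f i.castSucc) ⊗ₘ f (Fin.last (a + b)) := rfl
    have h := tensorHom_whiskerRight_comm ih (f (Fin.last (a + b)))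
    rw [e, ← Category.assoc]
    erw [h]
    rw [Category.assoc]
    erw [associator_naturality]
    rw [Category.assoc]
    rfl

theorem tpowMap_tsplit {X Y : C} (f : X ⟶ Y) (a b : ℕ) :
    tpowMap f (a + b) ≫ (tsplit Y a b).hom =
      (tsplit X a b).hom ≫ (tpowMap f a ⊗ₘ tpowMap f b) :=
  tmap_tsplit a b (fun _ => f)

end TensorFamilies

/-! ### Symmetries and insertion maps against families of morphisms. -/

section Permutations

variable {C : Type u} [Category.{v} C] [MonoidalCategory C] [SymmetricCategory C]

/-- Naturality of the symmetry, with the morphism allowed to vary from place to place: the summands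
of `fold` are not tensor powers of one morphism. -/
theorem tmap_moveLast {X Y : C} : ∀ (n : ℕ) (i : Fin (n + 1)) (f g : Fin (n + 1) → (X ⟶ Y)),
    g i = f (Fin.last n) → (∀ j : Fin n, g (i.succAbove j) = f j.castSucc) →
    tmap f ≫ moveLast Y n i = moveLast X n i ≫ tmap g
  | 0, i, f, g, h, _ => by
    have : f = g := by
      funext j
      obtain rfl : j = i := (Fin.fin_one_eq_zero j).trans (Fin.fin_one_eq_zero i).symm
      rw [h]
      congr 1
      exact Fin.fin_one_eq_zero j
    simp [moveLast, this]
  | n + 1, i, f, g, hi, hs => by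
    by_cases h : i = Fin.last (n + 1)
    · subst h
      have : f = g := by
        funext j
        refine Fin.lastCases hi.symm (fun j => ?_) j
        rw [← hs j, Fin.succAbove_last]
      simp [moveLast, this]
    -- As i is not the last place, the penultimate factor is the one that ends up last.
    · have hlast : g (Fin.last (n + 1)) = f (Fin.last n).castSucc := by
        rw [← hs, Fin.succAbove_of_le_castSucc _ _, Fin.succ_last]
        rw [Fin.le_def]
        have := Fin.val_lt_last h
        simp only [Fin.val_castSucc, Fin.val_last]
        omega
      -- After the swap of the last two factors, the recursive call sees f without its penultimate
      -- member, the last member taking the end place.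
      have ih := tmap_moveLast n (i.castPred h)
        (Fin.snoc (α := fun _ => X ⟶ Y) (fun j : Fin n => f j.castSucc.castSucc)
          (f (Fin.last (n + 1))))
        (fun j => g j.castSucc) (by simpa using hi) (by
          intro j
          simp only [Fin.snoc_castSucc]
          rw [← hs]
          congr 1
          rcases lt_or_ge j.castSucc (i.castPred h) with hlt | hle
          · rw [Fin.succAbove_of_castSucc_lt _ _ hlt, Fin.succAbove_of_castSucc_lt]
            exact hlt
          · rw [Fin.succAbove_of_le_castSucc _ _ hle, Fin.succAbove_of_le_castSucc]
            · rfl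
            · exact hle)
      rw [moveLast, moveLast, dif_neg h, dif_neg h]
      have e1 : tmap g = tmap (fun j => g j.castSucc) ⊗ₘ f (Fin.last n).castSucc := by
        rw [tmap, hlast]
      rw [e1]
      simp only [Category.assoc]
      rw [← tensorHom_whiskerRight_comm ih]
      simp only [tmap, Fin.snoc_castSucc, Fin.snoc_last]
      rw [associator_naturality_assoc, ← associator_inv_naturality_assoc]
      congr 1
      simp only [← id_tensorHom, tensorHom_comp_tensorHom_assoc, Category.id_comp,
        Category.comp_id, BraidedCategory.braiding_naturality]

theorem succAbove_dropLast {n m : ℕ} (e : Fin (n + 1) ≃ Fin (m + 1)) (j : Fin n) :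
    (e (Fin.last n)).succAbove (dropLast e j) = e j.castSucc := by
  have h : ((finSuccAboveEquiv (e (Fin.last n))) (dropLast e j) : Fin (m + 1)) =
      e j.castSucc := by
    have := finSuccAboveEquiv_apply (Fin.last n) j
    simp [dropLast, this]
  exact h

theorem tmap_tperm {X Y : C} : ∀ {n m : ℕ} (e : Fin n ≃ Fin m) (f : Fin n → (X ⟶ Y))
    (g : Fin m → (X ⟶ Y)), (∀ j, g (e j) = f j) → tmap f ≫ tperm Y e = tperm X e ≫ tmap g
  | 0, 0, _, _, _, _ => by simp [tperm, tmap]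
  | n + 1, m + 1, e, f, g, h => by
    have ih := tmap_tperm (dropLast e) (fun j => f j.castSucc)
      (fun j => g ((e (Fin.last n)).succAbove j))
      (fun j => by simp only [succAbove_dropLast, h])
    have hm := tmap_moveLast m (e (Fin.last n))
      (Fin.snoc (α := fun _ => X ⟶ Y) (fun j => g ((e (Fin.last n)).succAbove j))
        (f (Fin.last n))) g (by simp [h]) (by simp)
    simp only [tperm, Category.assoc]
    rw [← hm]
    simp only [tmap, Fin.snoc_castSucc, Fin.snoc_last]
    rw [← Category.assoc, ← Category.assoc]
    congr 1
    exact tensorHom_whiskerRight_comm ih _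
  | 0, _ + 1, e, _, _, _ => (e.symm 0).elim0
  | _ + 1, 0, e, _, _, _ => (e 0).elim0

/-- Naturality of insertion, block by block. The outer maps a and c are arbitrary because the
summands of `fold` act differently to the left and to the right of the inserted operation. -/
theorem insertOp_comp {X Y Z : C} {m : ℕ} {g : Z ⊗ tpow X m ⟶ X} {g' : Z ⊗ tpow Y m ⟶ Y}
    {b : tpow X m ⟶ tpow Y m} {h : X ⟶ Y} (hg : g ≫ h = (Z ◁ b) ≫ g') {p q : ℕ}
    (a : tpow X p ⟶ tpow Y p) (c : tpow X q ⟶ tpow Y q) :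
    insertOp g p q ≫ (tsplit X (p + 1) q).hom ≫ ((a ⊗ₘ h) ⊗ₘ c) ≫ (tsplit Y (p + 1) q).inv =
      (Z ◁ ((tsplit X (p + m) q).hom ≫ ((tsplit X p m).hom ▷ tpow X q) ≫ ((a ⊗ₘ b) ⊗ₘ c) ≫
        ((tsplit Y p m).inv ▷ tpow Y q) ≫ (tsplit Y (p + m) q).inv)) ≫ insertOp g' p q := by
  simp only [insertOp, MonoidalCategory.whiskerLeft_comp, Category.assoc, Iso.inv_hom_id_assoc,
    whiskerLeft_inv_hom_assoc]
  congr 2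
  have e1 : Z ◁ ((tsplit Y p m).inv ▷ tpow Y q) ≫ Z ◁ ((tsplit Y p m).hom ▷ tpow Y q) = 𝟙 _ := by
    rw [← MonoidalCategory.whiskerLeft_comp, inv_hom_whiskerRight,
      MonoidalCategory.whiskerLeft_id]
  rw [reassoc_of% e1, ← id_tensorHom Z, associator_inv_naturality_assoc]
  congr 1
  simp only [← Category.assoc]
  congr 1
  simp only [← tensorHom_id, tensorHom_comp_tensorHom, Category.comp_id, Category.id_comp]
  congr 1
  simp only [Category.assoc]
  rw [associator_inv_naturality_assoc, ← id_tensorHom, tensorHom_comp_tensorHom, hg,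
    tensorHom_comp_tensorHom_assoc, BraidedCategory.braiding_naturality, Category.comp_id,
    Category.id_comp,
    ← Category.id_comp b, ← tensorHom_comp_tensorHom_assoc, Category.id_comp,
    associator_naturality_assoc, ← id_tensorHom, ← id_tensorHom, tensorHom_comp_tensorHom,
    Category.comp_id]

end Permutations

/-! ### Combinatorics of words and their leftmost letter `1`. -/

section Leading

theorem lead_snoc_castSucc {n : ℕ} (w : Fin n → Fin 2) (c : Fin 2) (j : Fin n) :
    lead (Fin.snoc (α := fun _ => Fin 2) w c) j.castSucc = lead w j := by
  have h : (∀ i < j.castSucc, Fin.snoc (α := fun _ => Fin 2) w c i = 0) ↔ ∀ i < j, w i = 0 := by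
    constructor
    · intro h i hi
      simpa using h i.castSucc (by simpa using hi)
    · intro h i
      refine Fin.lastCases (fun hi => absurd hi (not_lt.2 (Fin.le_last _))) (fun i hi => ?_) i
      simpa using h i (by simpa using hi)
  simp [lead, h]

theorem lead_snoc_last {n : ℕ} (w : Fin n → Fin 2) (c : Fin 2) :
    lead (Fin.snoc (α := fun _ => Fin 2) w c) (Fin.last n) = if c = 1 ∧ w = 0 then 1 else 0 := by
  have h : (∀ i < Fin.last n, Fin.snoc (α := fun _ => Fin 2) w c i = 0) ↔ w = 0 := by
    constructor
    · intro h
      funext i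
      simpa using h i.castSucc (Fin.castSucc_lt_last i)
    · rintro rfl i
      refine Fin.lastCases (fun hi => absurd hi (lt_irrefl _)) (fun i _ => ?_) i
      simp
  simp [lead, h]

theorem lead_zero {n : ℕ} : lead (0 : Fin n → Fin 2) = 0 := by
  funext j
  simp [lead]

/-- The word with the single entry `1` at the place `k`. -/
def single {n : ℕ} (k : Fin n) : Fin n → Fin 2 := fun j => if j = k then 1 else 0

theorem single_self {n : ℕ} (k : Fin n) : single k k = 1 := if_pos rfl

theorem single_of_ne {n : ℕ} {j k : Fin n} (h : j ≠ k) : single k j = 0 := if_neg h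

theorem fin_two_ne_zero {c : Fin 2} : c ≠ 0 ↔ c = 1 := by omega

theorem lead_eq_single {n : ℕ} {w : Fin n → Fin 2} {k : Fin n} (hk : w k = 1)
    (h : ∀ i < k, w i = 0) : lead w = single k := by
  funext j
  rcases lt_trichotomy j k with hj | rfl | hj
  · simp [lead, single, h j hj, hj.ne]
  · rw [lead, single_self, if_pos ⟨hk, h⟩]
  · rw [lead, single_of_ne hj.ne', if_neg]
    rintro ⟨-, h'⟩
    simpa [hk] using h' k hj

theorem exists_lead_eq_single {n : ℕ} {w : Fin n → Fin 2} (hw : w ≠ 0) :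
    ∃ k, w k = 1 ∧ lead w = single k := by
  obtain ⟨k₀, hk₀⟩ := Function.ne_iff.1 hw
  obtain ⟨k, hk, hmin⟩ := wellFounded_lt.has_min {k : Fin n | w k = 1} ⟨k₀, fin_two_ne_zero.1 hk₀⟩
  exact ⟨k, hk, lead_eq_single hk fun i hi => by
    by_contra h
    exact hmin i (fin_two_ne_zero.1 h) hi⟩

theorem sum_single {n : ℕ} (k : Fin n) : ∑ i, (single k i : ℕ) = 1 := by
  rw [Finset.sum_eq_single k]
  · simp [single_self]
  · intro j _ hj
    simp [single_of_ne hj]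
  · simp

theorem eq_zero_of_sum_eq_zero {n : ℕ} {w : Fin n → Fin 2} (h : ∑ i, (w i : ℕ) = 0) : w = 0 := by
  funext i
  have := Finset.sum_eq_zero_iff.1 h i (Finset.mem_univ i)
  exact Fin.ext this

theorem eq_single_of_sum_eq_one {n : ℕ} {w : Fin n → Fin 2} (h : ∑ i, (w i : ℕ) = 1) {k : Fin n}
    (hk : w k = 1) : w = single k := by
  funext j
  by_cases hj : j = k
  · rw [hj, hk, single_self]
  · rw [single_of_ne hj]
    by_contra h'
    have h1 := fin_two_ne_zero.1 h'
    have := Finset.sum_le_univ_sum_of_nonneg (s := {j, k}) (f := fun i => (w i : ℕ))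
      (fun _ => Nat.zero_le _)
    rw [Finset.sum_pair hj, h] at this
    simp [h1, hk] at this

theorem exists_eq_single {n : ℕ} {w : Fin n → Fin 2} (h : ∑ i, (w i : ℕ) = 1) :
    ∃ k, w = single k := by
  have hw : w ≠ 0 := by
    rintro rfl
    simp at h
  obtain ⟨k, hk⟩ := Function.ne_iff.1 hw
  exact ⟨k, eq_single_of_sum_eq_one h (fin_two_ne_zero.1 hk)⟩

theorem sum_snoc {M : Type*} [AddCommMonoid M] {n : ℕ} (F : (Fin (n + 1) → Fin 2) → M) :
    ∑ w, F w = ∑ w : Fin n → Fin 2, (F (Fin.snoc (α := fun _ => Fin 2) w 0) +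
      F (Fin.snoc (α := fun _ => Fin 2) w 1)) := by
  rw [← (Fin.snocEquiv (fun _ : Fin (n + 1) => Fin 2)).sum_comp, Fintype.sum_prod_type_right]
  refine Finset.sum_congr rfl fun w _ => ?_
  rw [Fin.sum_univ_two]
  rfl

end Leading

/-! ### Additivity of the tensor product. -/

section Closed

/-- Tensoring on the left is a left adjoint, so it preserves binary coproducts, hence biproducts,
hence sums of morphisms. The braiding transports this to the right. -/
theorem monoidalPreadditive_of_closed (A : Type u) [Category.{v} A] [Abelian A]
    [MonoidalCategory A] [SymmetricCategory A] [MonoidalClosed A] : MonoidalPreadditive A := by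
  have hadd (X : A) : (tensorLeft X).Additive :=
    have := preservesBinaryBiproducts_of_preservesBinaryCoproducts (tensorLeft X)
    Functor.additive_of_preservesBinaryBiproducts _
  have hr {X Y Z : A} (f : Y ⟶ Z) : f ▷ X = (β_ Y X).hom ≫ (X ◁ f) ≫ (β_ X Z).hom := by
    simp
  have hz {X Y Z : A} : X ◁ (0 : Y ⟶ Z) = 0 := (tensorLeft X).map_zero Y Z
  have ha {X Y Z : A} (f g : Y ⟶ Z) : X ◁ (f + g) = X ◁ f + X ◁ g :=
    (tensorLeft X).map_add (f := f) (g := g)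
  exact
    { whiskerLeft_zero := hz
      zero_whiskerRight := by
        intro X Y Z
        rw [hr, hz, zero_comp, comp_zero]
      whiskerLeft_add := ha
      add_whiskerRight := by
        intro X Y Z f g
        rw [hr, ha, Preadditive.add_comp, Preadditive.comp_add, ← hr, ← hr] }

end Closed

/-! ### Matrix entries of endomorphisms of X ⊕ B and the folding map. -/

section Cells

variable {A : Type u} [Category.{v} A] [Abelian A] {X B : A}

theorem inc_prj_self : ∀ k : Fin 2, inc X B k ≫ prj X B k = 𝟙 _
  | 0 => biprod.inr_snd
  | 1 => biprod.inl_fst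

theorem inc_prj_of_ne : ∀ {k l : Fin 2}, k ≠ l → inc X B k ≫ prj X B l = 0
  | 0, 0, h => absurd rfl h
  | 1, 1, h => absurd rfl h
  | 0, 1, _ => biprod.inr_fst
  | 1, 0, _ => biprod.inl_snd

theorem step_self (d : X ⟶ B) : ∀ k : Fin 2, step d k k = 𝟙 _
  | 0 => rfl
  | 1 => rfl

theorem step_comp (d : X ⟶ B) : ∀ {k l m : Fin 2}, l ≤ k → m ≤ l →
    step d k l ≫ step d l m = step d k m
  | 0, 0, 0, _, _ => Category.id_comp _
  | 1, 0, 0, _, _ => Category.comp_id _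
  | 1, 1, 0, _, _ => Category.id_comp _
  | 1, 1, 1, _, _ => Category.id_comp _
  | 0, 1, _, h, _ => by simp at h
  | 0, 0, 1, _, h => by simp at h
  | 1, 0, 1, _, h => by simp at h

/-- The endomorphism of `X ⊕ B` with the single component `step d k l`. -/
def cell (d : X ⟶ B) (k l : Fin 2) : X ⊞ B ⟶ X ⊞ B := prj X B k ≫ step d k l ≫ inc X B l

/-- The idempotent of `X ⊕ B` with image `B`. -/
abbrev baseProj (X B : A) : X ⊞ B ⟶ X ⊞ B := biprod.snd ≫ biprod.inr

/-- The endomorphism `(x, b) ↦ (0, d x + b)` of `X ⊕ B`. -/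
abbrev target (d : X ⟶ B) : X ⊞ B ⟶ X ⊞ B := biprod.desc d (𝟙 B) ≫ biprod.inr

theorem cell_zero_zero (d : X ⟶ B) : cell d 0 0 = baseProj X B := by
  simp only [cell, step, prj, inc]
  erw [Category.id_comp]
  rfl

theorem cell_one_one (d : X ⟶ B) : cell d 1 1 = biprod.fst ≫ biprod.inl := by
  simp only [cell, step, prj, inc]
  erw [Category.id_comp]
  rfl

theorem cell_one_zero (d : X ⟶ B) : cell d 1 0 = biprod.fst ≫ d ≫ biprod.inr := rfl

theorem cell_zero_add_cell_one (d : X ⟶ B) : cell d 0 0 + cell d 1 0 = target d := by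
  rw [cell_zero_zero, cell_one_zero]
  apply biprod.hom_ext' <;> simp [target]

theorem cell_zero_add_cell_one_one (d : X ⟶ B) : cell d 0 0 + cell d 1 1 = 𝟙 _ := by
  rw [cell_zero_zero, cell_one_one]
  apply biprod.hom_ext' <;> simp

variable [MonoidalCategory A]

theorem tmap_cell (d : X ⟶ B) {n : ℕ} (w w' : Fin n → Fin 2) :
    tmap (fun j => cell d (w j) (w' j)) =
      wordPrj X B w ≫ wordStep d w w' ≫ wordInc X B w' := by
  rw [tmap_comp, tmap_comp]
  rfl

theorem tmap_snoc (d : X ⟶ B) {n : ℕ} (w w' : Fin n → Fin 2) (c : Fin 2)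
    (v : Fin (n + 1) → Fin 2) (h : ∀ j : Fin n, v j.castSucc = w' j) :
    tmap (fun j => cell d (Fin.snoc (α := fun _ => Fin 2) w c j) (v j)) =
      tmap (fun j => cell d (w j) (w' j)) ⊗ₘ cell d c (v (Fin.last n)) := by
  rw [tmap]
  simp only [Fin.snoc_castSucc, Fin.snoc_last, h]

/-- The endomorphism of `(X ⊕ B)^{⊗ n}` that applies `d`, on each summand, to all factors `X`
except the leftmost one. -/
def fold (d : X ⟶ B) (n : ℕ) : tpow (X ⊞ B) n ⟶ tpow (X ⊞ B) n :=
  ∑ w : Fin n → Fin 2, tmap (fun j => cell d (w j) (lead w j))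

/-- The part of `fold d n` with values of degree one. -/
def leadSum (d : X ⟶ B) (n : ℕ) : tpow (X ⊞ B) n ⟶ tpow (X ⊞ B) n :=
  fold d n - tpowMap (baseProj X B) n

theorem fold_eq (d : X ⟶ B) (n : ℕ) : fold d n = leadSum d n + tpowMap (baseProj X B) n :=
  (sub_add_cancel _ _).symm

theorem fold_zero (d : X ⟶ B) : fold d 0 = 𝟙 _ := by
  rw [fold, Fintype.sum_unique]
  rfl

theorem wordInc_wordPrj_self {n : ℕ} (w : Fin n → Fin 2) :
    wordInc X B w ≫ wordPrj X B w = 𝟙 _ := by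
  rw [tmap_comp]
  simp only [inc_prj_self, tmap_id]

theorem wordStep_self (d : X ⟶ B) {n : ℕ} (w : Fin n → Fin 2) : wordStep d w w = 𝟙 _ := by
  rw [wordStep]
  simp only [step_self, tmap_id]

theorem wordStep_comp (d : X ⟶ B) {n : ℕ} {w w' w'' : Fin n → Fin 2} (h : w' ≤ w)
    (h' : w'' ≤ w') : wordStep d w w' ≫ wordStep d w' w'' = wordStep d w w'' := by
  rw [tmap_comp]
  simp only [step_comp d (h _) (h' _)]

theorem leadSum_zero (d : X ⟶ B) : leadSum d 0 = 0 := by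
  rw [leadSum, fold_zero]
  exact sub_self _

end Cells

/-! ### Recursion on the word length for the folding map. -/

section Folding

variable {A : Type u} [Category.{v} A] [Abelian A] [MonoidalCategory A] [MonoidalPreadditive A]

theorem whiskerLeft_sub (Z : A) {X Y : A} (f g : X ⟶ Y) : Z ◁ (f - g) = Z ◁ f - Z ◁ g :=
  (tensorLeft Z).map_sub

theorem tensor_sub {W X Y Z : A} (f : W ⟶ X) (g h : Y ⟶ Z) :
    f ⊗ₘ (g - h) = f ⊗ₘ g - f ⊗ₘ h := by
  rw [eq_sub_iff_add_eq, ← MonoidalPreadditive.tensor_add, sub_add_cancel]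

theorem sub_tensor {W X Y Z : A} (f g : W ⟶ X) (h : Y ⟶ Z) :
    (f - g) ⊗ₘ h = f ⊗ₘ h - g ⊗ₘ h := by
  rw [eq_sub_iff_add_eq, ← MonoidalPreadditive.add_tensor, sub_add_cancel]

theorem tmap_eq_zero : ∀ {n : ℕ} {X Y : Fin n → A} (f : ∀ i, X i ⟶ Y i) (i : Fin n), f i = 0 →
    tmap f = 0
  | 0, _, _, _, i, _ => i.elim0
  | n + 1, _, _, f, i, h => by
    rw [tmap]
    revert h
    refine Fin.lastCases (fun h => ?_) (fun i h => ?_) i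
    · rw [h, MonoidalPreadditive.tensor_zero]
    · rw [tmap_eq_zero (fun i => f i.castSucc) i h, MonoidalPreadditive.zero_tensor]

variable {X B : A}

theorem wordInc_wordPrj_of_ne {n : ℕ} {w w' : Fin n → Fin 2} (h : w ≠ w') :
    wordInc X B w ≫ wordPrj X B w' = 0 := by
  obtain ⟨k, hk⟩ := Function.ne_iff.1 h
  rw [tmap_comp]
  exact tmap_eq_zero _ k (inc_prj_of_ne hk)

theorem wordStep_eq_zero (d : X ⟶ B) {n : ℕ} {w w' : Fin n → Fin 2} (k : Fin n) (h : w k = 0)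
    (h' : w' k = 1) : wordStep d w w' = 0 := by
  refine tmap_eq_zero _ k ?_
  rw [h, h']
  rfl

/-- Once a `1` has occurred among the first n letters, the last letter always goes to degree zero,
and its two cases add up to `target`. The second summand corrects this for the zero prefix, where a
final `1` is leftmost and is kept. -/
theorem fold_succ (d : X ⟶ B) (n : ℕ) : fold d (n + 1) =
    (fold d n ⊗ₘ target d) + (tpowMap (baseProj X B) n ⊗ₘ (𝟙 (X ⊞ B) - target d)) := by
  have h (w : Fin n → Fin 2) :
      (tmap (fun j => cell d (Fin.snoc (α := fun _ => Fin 2) w 0 j)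
          (lead (Fin.snoc (α := fun _ => Fin 2) w 0) j)) +
        tmap (fun j => cell d (Fin.snoc (α := fun _ => Fin 2) w 1 j)
          (lead (Fin.snoc (α := fun _ => Fin 2) w 1) j))) =
      (tmap (fun j => cell d (w j) (lead w j)) ⊗ₘ target d) +
        if w = 0 then (tpowMap (baseProj X B) n ⊗ₘ (𝟙 (X ⊞ B) - target d)) else 0 := by
    rw [tmap_snoc d w (lead w) 0 _ (lead_snoc_castSucc w 0),
      tmap_snoc d w (lead w) 1 _ (lead_snoc_castSucc w 1), ← MonoidalPreadditive.tensor_add,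
      lead_snoc_last, lead_snoc_last]
    by_cases hw : w = 0
    · subst hw
      have e : tpowMap (baseProj X B) n =
          tmap (fun j => cell d ((0 : Fin n → Fin 2) j) (lead (0 : Fin n → Fin 2) j)) := by
        simp only [lead_zero, Pi.zero_apply, cell_zero_zero]
      -- Over the zero prefix the last factor carries the cells 0 → 0 and 1 → 1, with sum the
      -- identity, which is `target` plus the correction.
      rw [if_pos rfl, e, ← MonoidalPreadditive.tensor_add, add_sub_cancel,
        ← cell_zero_add_cell_one_one d]
      simp
    · simp [hw, cell_zero_add_cell_one]
  rw [fold, sum_snoc]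
  simp only [h]
  rw [Finset.sum_add_distrib, Finset.sum_ite_eq' Finset.univ, if_pos (Finset.mem_univ _), fold,
    ← sum_tensor]

theorem tpowMap_target (d : X ⟶ B) : ∀ n : ℕ,
    tpowMap (target d) n = ∑ w : Fin n → Fin 2, tmap (fun j => cell d (w j) 0)
  | 0 => by
    rw [Fintype.sum_unique]
    rfl
  | n + 1 => by
    have h (w : Fin n → Fin 2) (c : Fin 2) := tmap_snoc d w 0 c 0 (fun _ => rfl)
    simp only [Pi.zero_apply] at h
    rw [sum_snoc]
    simp only [h, ← MonoidalPreadditive.tensor_add, cell_zero_add_cell_one]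
    rw [← sum_tensor, ← tpowMap_target d n]
    rfl

/-- Either the leftmost X is among the first n factors, and the last factor is sent into B, or it is
the last factor and all earlier ones lie in B. -/
theorem leadSum_succ (d : X ⟶ B) (n : ℕ) : leadSum d (n + 1) =
    (leadSum d n ⊗ₘ target d) +
      (tpowMap (baseProj X B) n ⊗ₘ (biprod.fst ≫ biprod.inl : X ⊞ B ⟶ X ⊞ B)) := by
  have e : tpowMap (baseProj X B) (n + 1) = tpowMap (baseProj X B) n ⊗ₘ baseProj X B := rfl
  rw [leadSum, fold_succ, e, leadSum, sub_tensor, ← cell_one_one d, ← cell_zero_zero d,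
    ← cell_zero_add_cell_one_one d, tensor_sub, MonoidalPreadditive.tensor_add]
  abel

end Folding

/-! ### Folding against concatenation and insertion. -/

section Splitting

variable {A : Type u} [Category.{v} A] [Abelian A] [MonoidalCategory A] [MonoidalPreadditive A]
  {X B : A}

/-- The leftmost X lies in the first block, so that the whole second block is sent into B, or in the
second, so that the first block lies in B. -/
theorem leadSum_tsplit (d : X ⟶ B) (a : ℕ) : ∀ b : ℕ,
    leadSum d (a + b) ≫ (tsplit (X ⊞ B) a b).hom = (tsplit (X ⊞ B) a b).hom ≫
      ((leadSum d a ⊗ₘ tpowMap (target d) b) + (tpowMap (baseProj X B) a ⊗ₘ leadSum d b))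
  | 0 => by
    have e : tpowMap (target d) 0 = 𝟙 _ := rfl
    have h : (leadSum d a ⊗ₘ tpowMap (target d) 0) + (tpowMap (baseProj X B) a ⊗ₘ leadSum d 0) =
        leadSum d a ▷ 𝟙_ A := by
      rw [leadSum_zero, MonoidalPreadditive.tensor_zero, add_zero, e, tensorHom_id]
    rw [h]
    exact rightUnitor_inv_naturality _
  | b + 1 => by
    have ih := leadSum_tsplit d a b
    have h1 := tensorHom_whiskerRight_comm ih (target d)
    have h2 := tensorHom_whiskerRight_comm (tpowMap_tsplit (baseProj X B) a b)
      (biprod.fst ≫ biprod.inl : X ⊞ B ⟶ X ⊞ B)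
    have e1 : leadSum d (a + (b + 1)) = _ := leadSum_succ d (a + b)
    have e2 : (tsplit (X ⊞ B) a (b + 1)).hom = ((tsplit (X ⊞ B) a b).hom ▷ (X ⊞ B)) ≫
      (α_ _ _ _).hom := rfl
    have e3 : tpowMap (target d) (b + 1) = tpowMap (target d) b ⊗ₘ target d := rfl
    rw [e1, e2, ← Category.assoc]
    erw [Preadditive.add_comp, h1, h2]
    rw [← Preadditive.comp_add, MonoidalPreadditive.add_tensor, Category.assoc, Category.assoc,
      Preadditive.add_comp, Preadditive.add_comp, e3, leadSum_succ, MonoidalPreadditive.tensor_add]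
    congr 1
    rw [associator_naturality, associator_naturality, associator_naturality, ← add_assoc,
      ← Preadditive.comp_add, ← Preadditive.comp_add]

/-- For use with g = `op` and g' = `total`. The output of g is one factor among the outer inputs,
and folding treats it by `target`, by the projection on X or by the projection on B. The three
hypotheses move these operations to the inputs of g. -/
theorem insertOp_fold [SymmetricCategory A] (d : X ⟶ B) {Z : A} {m : ℕ}
    {g g' : Z ⊗ tpow (X ⊞ B) m ⟶ X ⊞ B}
    (ht : g ≫ target d = (Z ◁ tpowMap (target d) m) ≫ g')
    (hl : g ≫ biprod.fst ≫ biprod.inl = (Z ◁ leadSum d m) ≫ g')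
    (hb : g ≫ baseProj X B = (Z ◁ tpowMap (baseProj X B) m) ≫ g') (p q : ℕ) :
    insertOp g p q ≫ fold d (p + 1 + q) = (Z ◁ fold d (p + m + q)) ≫ insertOp g' p q := by
  have hP (a b : ℕ) : tpowMap (baseProj X B) (a + b) = (tsplit (X ⊞ B) a b).hom ≫
      (tpowMap (baseProj X B) a ⊗ₘ tpowMap (baseProj X B) b) ≫ (tsplit (X ⊞ B) a b).inv := by
    rw [← Category.assoc, Iso.eq_comp_inv, tpowMap_tsplit]
  have hT (a b : ℕ) : tpowMap (target d) (a + b) = (tsplit (X ⊞ B) a b).hom ≫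
      (tpowMap (target d) a ⊗ₘ tpowMap (target d) b) ≫ (tsplit (X ⊞ B) a b).inv := by
    rw [← Category.assoc, Iso.eq_comp_inv, tpowMap_tsplit]
  have hS (a b : ℕ) : leadSum d (a + b) = (tsplit (X ⊞ B) a b).hom ≫
      ((leadSum d a ⊗ₘ tpowMap (target d) b) + (tpowMap (baseProj X B) a ⊗ₘ leadSum d b)) ≫
        (tsplit (X ⊞ B) a b).inv := by
    rw [← Category.assoc, Iso.eq_comp_inv, leadSum_tsplit]
  have hF (a b : ℕ) : fold d (a + b) = (tsplit (X ⊞ B) a b).hom ≫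
      ((leadSum d a ⊗ₘ tpowMap (target d) b) + (tpowMap (baseProj X B) a ⊗ₘ fold d b)) ≫
        (tsplit (X ⊞ B) a b).inv := by
    rw [fold_eq, fold_eq d b, hS, hP, ← Preadditive.comp_add, ← Preadditive.add_comp,
      MonoidalPreadditive.tensor_add, add_assoc]
  have e1 : tpowMap (baseProj X B) (p + 1) = tpowMap (baseProj X B) p ⊗ₘ baseProj X B := rfl
  have k1 := insertOp_comp ht (p := p) (q := q) (leadSum d p) (tpowMap (target d) q)
  have k2 := insertOp_comp hl (p := p) (q := q) (tpowMap (baseProj X B) p) (tpowMap (target d) q)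
  have k3 := insertOp_comp hb (p := p) (q := q) (tpowMap (baseProj X B) p) (fold d q)
  -- The three terms: the leftmost X is in the left block; it is the inserted output; or neither of
  -- these, so that the right block is folded by itself.
  have hL : insertOp g p q ≫ fold d (p + 1 + q) =
      insertOp g p q ≫ (tsplit (X ⊞ B) (p + 1) q).hom ≫
        ((leadSum d p ⊗ₘ target d) ⊗ₘ tpowMap (target d) q) ≫ (tsplit (X ⊞ B) (p + 1) q).inv +
      insertOp g p q ≫ (tsplit (X ⊞ B) (p + 1) q).hom ≫
        ((tpowMap (baseProj X B) p ⊗ₘ biprod.fst ≫ biprod.inl) ⊗ₘ tpowMap (target d) q) ≫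
          (tsplit (X ⊞ B) (p + 1) q).inv +
      insertOp g p q ≫ (tsplit (X ⊞ B) (p + 1) q).hom ≫
        ((tpowMap (baseProj X B) p ⊗ₘ baseProj X B) ⊗ₘ fold d q) ≫
          (tsplit (X ⊞ B) (p + 1) q).inv := by
    rw [hF, leadSum_succ, e1, MonoidalPreadditive.add_tensor]
    simp only [Preadditive.comp_add, Preadditive.add_comp]
  have hW (a : tpow (X ⊞ B) (p + m) ⟶ tpow (X ⊞ B) (p + m)) (b : tpow (X ⊞ B) p ⊗ tpow (X ⊞ B) m ⟶
      tpow (X ⊞ B) p ⊗ tpow (X ⊞ B) m) (h : a = (tsplit (X ⊞ B) p m).hom ≫ b ≫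
        (tsplit (X ⊞ B) p m).inv) (c : tpow (X ⊞ B) q ⟶ tpow (X ⊞ B) q) :
      a ⊗ₘ c = ((tsplit (X ⊞ B) p m).hom ▷ tpow (X ⊞ B) q) ≫ (b ⊗ₘ c) ≫
        ((tsplit (X ⊞ B) p m).inv ▷ tpow (X ⊞ B) q) := by
    rw [h]
    simp only [← tensorHom_id, tensorHom_comp_tensorHom, Category.id_comp, Category.comp_id]
  rw [hL, k1, k2, k3, hF (p + m) q, hW _ _ (hS p m), hW _ _ (hP p m),
    MonoidalPreadditive.add_tensor]
  simp only [Preadditive.comp_add, Preadditive.add_comp, Category.assoc,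
    MonoidalPreadditive.whiskerLeft_add]

end Splitting

/-! ### Leibniz and Koszul signs on words of low degree. -/

section Signs

theorem leibnizSign_single_zero {n : ℕ} (k : Fin n) : leibnizSign (single k) 0 = 1 := by
  refine Finset.prod_eq_one fun i _ => Finset.prod_eq_one fun j _ => ?_
  split_ifs with h
  · obtain ⟨hj, hi⟩ := h
    have hk : i = k := by
      by_contra hk
      exact hi (single_of_ne hk)
    rw [single_of_ne (hk ▸ hj.ne)]
    rfl
  · rfl

/-- Here d acts at l and has to pass the degree-one factor at k. -/
theorem leibnizSign_pair_left {n : ℕ} {v : Fin n → Fin 2} {k l : Fin n} (hkl : k < l)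
    (hk : v k = 1) (hl : v l = 1) (hv : ∀ j, j ≠ k → j ≠ l → v j = 0) :
    leibnizSign v (single k) = -1 := by
  have hne {i : Fin n} (hi : i ≠ l) : v i = single k i := by
    by_cases h : i = k
    · rw [h, hk, single_self]
    · rw [hv i h hi, single_of_ne h]
  rw [leibnizSign, Finset.prod_eq_single l, Finset.prod_eq_single k]
  · rw [if_pos ⟨hkl, by rw [hl, single_of_ne hkl.ne']; decide⟩, hk]
    rfl
  · intro j _ hj
    split_ifs with h
    · rw [hv j hj h.1.ne]
      rfl
    · rfl
  · simp
  · intro i _ hi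
    exact Finset.prod_eq_one fun j _ => if_neg fun h => h.2 (hne hi)
  · simp

/-- Here d acts at k, before which all factors have degree zero. -/
theorem leibnizSign_pair_right {n : ℕ} {v : Fin n → Fin 2} {k l : Fin n} (hkl : k < l)
    (hl : v l = 1) (hv : ∀ j, j ≠ k → j ≠ l → v j = 0) :
    leibnizSign v (single l) = 1 := by
  refine Finset.prod_eq_one fun i _ => Finset.prod_eq_one fun j _ => ?_
  split_ifs with h
  · obtain ⟨hj, hi⟩ := h
    have hik : i = k := by
      by_contra hik
      apply hi
      by_cases hil : i = l
      · rw [hil, hl, single_self]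
      · rw [hv i hik hil, single_of_ne hil]
    subst hik
    rw [hv j hj.ne (hj.trans hkl).ne]
    rfl
  · rfl

theorem koszulSign_eq_one {n m : ℕ} (e : Fin n ≃ Fin m) {w : Fin n → Fin 2}
    (h : ∑ i, (w i : ℕ) ≤ 1) : koszulSign e w = 1 := by
  refine Finset.prod_eq_one fun i _ => Finset.prod_eq_one fun j _ => ?_
  split_ifs with hij
  · have h0 : (w i : ℕ) * (w j : ℕ) = 0 := by
      have := Finset.sum_le_univ_sum_of_nonneg (s := {i, j}) (f := fun i => (w i : ℕ))
        (fun _ => Nat.zero_le _)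
      rw [Finset.sum_pair hij.1.ne] at this
      rcases Nat.eq_zero_or_pos (w i : ℕ) with h1 | h1
      · rw [h1, zero_mul]
      · rw [(by omega : (w j : ℕ) = 0), mul_zero]
    rw [h0, pow_zero]
  · rfl

end Signs

section Cells

variable {A : Type u} [Category.{v} A] [Abelian A]

theorem prj_inc_prj {X B : A} {k l : Fin 2} (h : k = l) :
    (prj X B k ≫ inc X B k) ≫ prj X B l = prj X B l := by
  subst h
  rw [Category.assoc, inc_prj_self, Category.comp_id]

end Cells

/-! ### The unfolded operations on V₁ ⊕ V₀ and the two chain conditions. -/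

section TotalOperations

variable {A : Type u} [Category.{v} A] [Abelian A] [MonoidalCategory A]

theorem totalMap_fst {V₁ V₀ Z : A} {n : ℕ} (f₁ : Z ⊗ cpow V₁ V₀ n 1 ⟶ V₁)
    (f₀ : Z ⊗ cpow V₁ V₀ n 0 ⟶ V₀) :
    totalMap f₁ f₀ ≫ biprod.fst = (Z ◁ cpowPrj V₁ V₀ n 1) ≫ f₁ := biprod.lift_fst _ _

theorem totalMap_snd {V₁ V₀ Z : A} {n : ℕ} (f₁ : Z ⊗ cpow V₁ V₀ n 1 ⟶ V₁)
    (f₀ : Z ⊗ cpow V₁ V₀ n 0 ⟶ V₀) :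
    totalMap f₁ f₀ ≫ biprod.snd = (Z ◁ cpowPrj V₁ V₀ n 0) ≫ f₀ := biprod.lift_snd _ _

/-- The inclusion of a summand of the degree `k` part of the tensor power. -/
def cpowι (X B : A) {n k : ℕ} (w : Words n k) : word X B w.1 ⟶ cpow X B n k :=
  biproduct.ι (fun w : Words n k => word X B w.1) w

/-- The projection on a summand of the degree `k` part of the tensor power. -/
def cpowπ (X B : A) {n k : ℕ} (w : Words n k) : cpow X B n k ⟶ word X B w.1 :=
  biproduct.π (fun w : Words n k => word X B w.1) w

theorem cpow_hom_ext {X B Z : A} {n k : ℕ} {f g : Z ⟶ cpow X B n k}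
    (h : ∀ w, f ≫ cpowπ X B w = g ≫ cpowπ X B w) : f = g :=
  biproduct.hom_ext _ _ h

theorem cpowPrj_π (X B : A) {n k : ℕ} (w : Words n k) :
    cpowPrj X B n k ≫ cpowπ X B w = wordPrj X B w.1 :=
  biproduct.lift_π _ _

theorem cpowPrj_eq_sum (X B : A) (n k : ℕ) :
    cpowPrj X B n k = ∑ w : Words n k, wordPrj X B w.1 ≫ cpowι X B w :=
  biproduct.lift_eq

theorem cpowι_π_self (X B : A) {n k : ℕ} (w : Words n k) :
    cpowι X B w ≫ cpowπ X B w = 𝟙 _ :=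
  biproduct.ι_π_self _ w

theorem cpowι_π_of_ne (X B : A) {n k : ℕ} {w w' : Words n k} (h : w ≠ w') :
    cpowι X B w ≫ cpowπ X B w' = 0 :=
  biproduct.ι_π_ne _ h

theorem ι_cpowD {V₁ V₀ : A} (d : V₁ ⟶ V₀) (n k : ℕ) (w : Words n (k + 1)) :
    cpowι V₁ V₀ w ≫ cpowD d n k =
      ∑ w' : Words n k, leibnizSign w.1 w'.1 • (wordStep d w.1 w'.1 ≫ cpowι V₁ V₀ w') := by
  have h : cpowι V₁ V₀ w ≫ cpowD d n k = biproduct.lift (fun w' : Words n k =>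
      leibnizSign w.1 w'.1 • wordStep d w.1 w'.1) := biproduct.ι_matrix _ _
  rw [h, biproduct.lift_eq]
  exact Finset.sum_congr rfl fun w' _ => Preadditive.zsmul_comp _ _ _

theorem ι_cpowPerm_π [SymmetricCategory A] (V₁ V₀ : A) {n m : ℕ} (e : Fin n ≃ Fin m) {k : ℕ}
    (w : Words n k) (w' : Words m k) : cpowι V₁ V₀ w ≫ cpowPerm V₁ V₀ e k ≫ cpowπ V₁ V₀ w' =
      koszulSign e w.1 • (wordInc V₁ V₀ w.1 ≫ tperm (V₁ ⊞ V₀) e ≫ wordPrj V₁ V₀ w'.1) := by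
  have h : cpowPerm V₁ V₀ e k ≫ cpowπ V₁ V₀ w' = biproduct.desc (fun w : Words n k =>
      koszulSign e w.1 • (wordInc V₁ V₀ w.1 ≫ tperm (V₁ ⊞ V₀) e ≫ wordPrj V₁ V₀ w'.1)) :=
    biproduct.matrix_π _ _
  rw [h]
  exact biproduct.ι_desc _ _

namespace ComplexAlg

variable [SymmetricCategory A] {P : Operad A} {V₁ V₀ : A} {d : V₁ ⟶ V₀} (S : ComplexAlg P d)

/-- The structure maps of the algebra on the total object, without sign corrections. -/
abbrev total (n : ℕ) : P.obj n ⊗ tpow (V₁ ⊞ V₀) n ⟶ V₁ ⊞ V₀ := totalMap (S.μ₁ n) (S.μ₀ n)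

/-- The restriction of the structure map to the words with a single factor `V₁`. -/
def linear {n : ℕ} (k : Fin n) : P.obj n ⊗ word V₁ V₀ (single k) ⟶ V₁ :=
  (P.obj n ◁ cpowι V₁ V₀ ⟨single k, sum_single k⟩) ≫ S.μ₁ n

/-- The restriction of the structure map to the word without factors `V₁`. -/
def constant (n : ℕ) : P.obj n ⊗ word V₁ V₀ (0 : Fin n → Fin 2) ⟶ V₀ :=
  (P.obj n ◁ cpowι V₁ V₀ ⟨0, by simp⟩) ≫ S.μ₀ n

/-- The chain condition from degree 1 to degree 0, on one summand: the differential of a word with a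
single `1` has one component, with sign +1. -/
theorem linear_comp {n : ℕ} (k : Fin n) :
    S.linear k ≫ d = (P.obj n ◁ wordStep d (single k) 0) ≫ S.constant n := by
  have hz (w : Words n 0) : w = ⟨0, by simp⟩ := Subtype.ext (eq_zero_of_sum_eq_zero w.2)
  rw [linear, Category.assoc, ← S.chain₁, ← whiskerLeft_comp_assoc, ι_cpowD, Fintype.sum_eq_single
    ⟨0, by simp⟩ (fun w hw => absurd (hz w) hw), leibnizSign_single_zero, one_zsmul,
    MonoidalCategory.whiskerLeft_comp_assoc]
  rfl

end ComplexAlg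

variable [MonoidalPreadditive A]

theorem wordInc_cpowPrj (X B : A) {n k : ℕ} (w : Words n k) :
    wordInc X B w.1 ≫ cpowPrj X B n k = cpowι X B w := by
  apply cpow_hom_ext
  intro w'
  rw [Category.assoc, cpowPrj_π]
  by_cases h : w = w'
  · subst h
    rw [wordInc_wordPrj_self, cpowι_π_self]
  · rw [wordInc_wordPrj_of_ne (fun h' => h (Subtype.ext h')), cpowι_π_of_ne _ _ h]

theorem wordInc_cpowPrj_of_ne (X B : A) {n k : ℕ} {w : Fin n → Fin 2}
    (h : ∑ i, (w i : ℕ) ≠ k) : wordInc X B w ≫ cpowPrj X B n k = 0 := by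
  apply cpow_hom_ext
  intro w'
  rw [Category.assoc, cpowPrj_π, zero_comp]
  exact wordInc_wordPrj_of_ne (fun h' => h (by rw [h', w'.2]))

variable [SymmetricCategory A] {P : Operad A} {V₁ V₀ : A} {d : V₁ ⟶ V₀} (S : ComplexAlg P d)

namespace ComplexAlg

theorem wordInc_total {n : ℕ} (k : Fin n) :
    (P.obj n ◁ wordInc V₁ V₀ (single k)) ≫ S.total n = S.linear k ≫ biprod.inl := by
  apply biprod.hom_ext
  · rw [Category.assoc, totalMap_fst, ← whiskerLeft_comp_assoc,
      wordInc_cpowPrj V₁ V₀ ⟨single k, sum_single k⟩, Category.assoc, biprod.inl_fst,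
      Category.comp_id]
    rfl
  · rw [Category.assoc, totalMap_snd, ← whiskerLeft_comp_assoc,
      wordInc_cpowPrj_of_ne V₁ V₀ (by rw [sum_single]; exact one_ne_zero), Category.assoc,
      biprod.inl_snd, MonoidalPreadditive.whiskerLeft_zero, zero_comp, comp_zero]

theorem wordInc_zero_total (n : ℕ) :
    (P.obj n ◁ wordInc V₁ V₀ (0 : Fin n → Fin 2)) ≫ S.total n = S.constant n ≫ biprod.inr := by
  apply biprod.hom_ext
  · rw [Category.assoc, totalMap_fst, ← whiskerLeft_comp_assoc,
      wordInc_cpowPrj_of_ne V₁ V₀ (by simp), Category.assoc,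
      biprod.inr_fst, MonoidalPreadditive.whiskerLeft_zero, zero_comp, comp_zero]
  · rw [Category.assoc, totalMap_snd, ← whiskerLeft_comp_assoc,
      wordInc_cpowPrj V₁ V₀ ⟨0, by simp⟩, Category.assoc, biprod.inr_snd,
      Category.comp_id]
    rfl

theorem inr_total (n : ℕ) :
    (P.obj n ◁ tpowMap biprod.inr n) ≫ S.total n = S.base n ≫ biprod.inr :=
  S.wordInc_zero_total n

/-- The chain condition from degree 2 to degree 1, on the word with `1` exactly at k and l. Its
differential has two terms of opposite signs, so the two ways of sparing one letter agree under
`μ₁`. -/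
theorem wordStep_linear_of_lt {n : ℕ} {w : Fin n → Fin 2} {k l : Fin n} (hkl : k < l)
    (hk : w k = 1) (hl : w l = 1) :
    (P.obj n ◁ wordStep d w (single k)) ≫ S.linear k =
      (P.obj n ◁ wordStep d w (single l)) ≫ S.linear l := by
  -- Both sides factor through v: first d is applied at all `1`s of w other than k and l.
  let v : Fin n → Fin 2 := fun j => if j = k ∨ j = l then 1 else 0
  have vk : v k = 1 := if_pos (Or.inl rfl)
  have vl : v l = 1 := if_pos (Or.inr rfl)
  have vz (j) (h : j ≠ k) (h' : j ≠ l) : v j = 0 := if_neg (by simp [h, h'])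
  have hv : ∑ i, (v i : ℕ) = 1 + 1 := by
    rw [Finset.sum_eq_add_of_mem k l (Finset.mem_univ _) (Finset.mem_univ _) hkl.ne
      (fun c _ hc => by rw [vz c hc.1 hc.2]; rfl), vk, vl]
    rfl
  have hs {j : Fin n} (hj : v j = 1) : single j ≤ v := fun i => by
    by_cases h : i = j
    · rw [h, hj, single_self]
    · rw [single_of_ne h]
      exact Fin.zero_le _
  have hvw : v ≤ w := fun i => by
    by_cases h : i = k
    · rw [h, hk, vk]
    · by_cases h' : i = l
      · rw [h', hl, vl]
      · rw [vz i h h']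
        exact Fin.zero_le _
  have h2 := congrArg (fun f => (P.obj n ◁ wordStep d w v) ≫ (P.obj n ◁ cpowι V₁ V₀ ⟨v, hv⟩) ≫ f)
    (S.chain₂ n)
  have e := ι_cpowD d n 1 ⟨v, hv⟩
  rw [Fintype.sum_eq_add (⟨single k, sum_single k⟩ : Words n 1) ⟨single l, sum_single l⟩
    (fun h => by
      have := congrFun (congrArg Subtype.val h) k
      simp only [single_self, single_of_ne hkl.ne] at this
      exact one_ne_zero this)
    (fun w' hw' => by
      obtain ⟨w', h'⟩ := w'
      obtain ⟨i, rfl⟩ := exists_eq_single h'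
      have hik : i ≠ k := fun h => hw'.1 (by subst h; rfl)
      have hil : i ≠ l := fun h => hw'.2 (by subst h; rfl)
      rw [wordStep_eq_zero d i (vz i hik hil) (single_self i), zero_comp, smul_zero]),
    leibnizSign_pair_left hkl vk vl vz, leibnizSign_pair_right hkl vl vz, one_zsmul,
    neg_one_zsmul] at e
  simp only [comp_zero] at h2
  rw [← whiskerLeft_comp_assoc (P.obj n) (cpowι V₁ V₀ _), e, ← whiskerLeft_comp_assoc, Preadditive.comp_add, Preadditive.comp_neg, neg_add_eq_sub,
    ← Category.assoc, ← Category.assoc, wordStep_comp d hvw (hs vl), wordStep_comp d hvw (hs vk),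
    whiskerLeft_sub, Preadditive.sub_comp, sub_eq_zero, MonoidalCategory.whiskerLeft_comp_assoc,
    MonoidalCategory.whiskerLeft_comp_assoc] at h2
  exact h2.symm

theorem wordStep_linear {n : ℕ} {w : Fin n → Fin 2} {k l : Fin n}
    (hk : w k = 1) (hl : w l = 1) :
    (P.obj n ◁ wordStep d w (single k)) ≫ S.linear k =
      (P.obj n ◁ wordStep d w (single l)) ≫ S.linear l := by
  rcases lt_trichotomy k l with h | rfl | h
  · exact S.wordStep_linear_of_lt h hk hl
  · rfl
  · exact (S.wordStep_linear_of_lt h hl hk).symm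

theorem tmap_cell_total {n : ℕ} {w : Fin n → Fin 2} {k l : Fin n} (hk : w k = 1) (hl : w l = 1) :
    (P.obj n ◁ tmap (fun j => cell d (w j) (single k j))) ≫ S.total n =
      (P.obj n ◁ tmap (fun j => cell d (w j) (single l j))) ≫ S.total n := by
  simp only [tmap_cell, MonoidalCategory.whiskerLeft_comp, Category.assoc, S.wordInc_total]
  rw [reassoc_of% S.wordStep_linear hk hl]

/-- With at most one odd factor all Koszul signs are 1, so the symmetry of complexes agrees with the
unsigned one on V₁ ⊕ V₀. -/
theorem cpowPrj_cpowPerm {n m : ℕ} (e : Fin n ≃ Fin m) {k : ℕ} (hk : k ≤ 1) :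
    cpowPrj V₁ V₀ n k ≫ cpowPerm V₁ V₀ e k = tperm (V₁ ⊞ V₀) e ≫ cpowPrj V₁ V₀ m k := by
  apply cpow_hom_ext
  intro w'
  have hw' : ∑ i, (w'.1 (e i) : ℕ) = k := by
    rw [e.sum_comp (fun i => (w'.1 i : ℕ)), w'.2]
  have ht (w : Words n k) : wordPrj V₁ V₀ w.1 ≫ wordInc V₁ V₀ w.1 ≫ tperm (V₁ ⊞ V₀) e ≫
      wordPrj V₁ V₀ w'.1 = tperm (V₁ ⊞ V₀) e ≫ tmap (fun j => (prj V₁ V₀ (w.1 (e.symm j)) ≫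
        inc V₁ V₀ (w.1 (e.symm j))) ≫ prj V₁ V₀ (w'.1 j)) := by
    rw [← tmap_comp, ← Category.assoc, tmap_comp, ← Category.assoc, ← Category.assoc]
    congr 1
    exact tmap_tperm e _ _ (fun j => by rw [e.symm_apply_apply])
  rw [Category.assoc, Category.assoc, cpowPrj_π, cpowPrj_eq_sum, Preadditive.sum_comp]
  simp only [Category.assoc, ι_cpowPerm_π]
  -- Only the word that e carries to w' has a nonzero component.
  rw [Fintype.sum_eq_single ⟨fun i => w'.1 (e i), hw'⟩]
  · rw [koszulSign_eq_one e (hw'.trans_le hk), one_zsmul, ht]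
    congr 2
    funext j
    exact prj_inc_prj (congrArg w'.1 (e.apply_symm_apply j))
  · intro w hw
    have : ∃ i, w.1 i ≠ w'.1 (e i) := by
      by_contra! h
      exact hw (Subtype.ext (funext h))
    obtain ⟨i, hi⟩ := this
    rw [Preadditive.comp_zsmul, ht, tmap_eq_zero _ (e i), comp_zero, smul_zero]
    rw [Category.assoc, inc_prj_of_ne (by rwa [e.symm_apply_apply]), comp_zero]

theorem total_equivariant {n m : ℕ} (e : Fin n ≃ Fin m) :
    (P.act e ▷ tpow (V₁ ⊞ V₀) n) ≫ S.total n = (P.obj m ◁ tperm (V₁ ⊞ V₀) e) ≫ S.total m := by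
  apply biprod.hom_ext
  · rw [Category.assoc, Category.assoc, totalMap_fst, totalMap_fst, ← whisker_exchange_assoc,
      S.equivariant₁, ← whiskerLeft_comp_assoc, ← whiskerLeft_comp_assoc,
      cpowPrj_cpowPerm e le_rfl]
  · rw [Category.assoc, Category.assoc, totalMap_snd, totalMap_snd, ← whisker_exchange_assoc,
      S.equivariant₀, ← whiskerLeft_comp_assoc, ← whiskerLeft_comp_assoc,
      cpowPrj_cpowPerm e zero_le_one]

end ComplexAlg

end TotalOperations

/-! ### Algebra structures on subobjects closed under the operations. -/

section Restriction

variable {C : Type u} [Category.{v} C] [MonoidalCategory C] [SymmetricCategory C]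

/-- The structure of algebra on a subobject that is closed under the operations. -/
def Alg.restrict {P : Operad C} {X Y : C} (a : Alg P Y) (f : X ⟶ Y) [Mono f]
    (μ : ∀ n, P.obj n ⊗ tpow X n ⟶ X)
    (h : ∀ n, (P.obj n ◁ tpowMap f n) ≫ a.μ n = μ n ≫ f) : Alg P X where
  μ := μ
  unit := by
    have e : tpowMap f 1 = 𝟙_ C ◁ f := id_tensorHom _ _
    rw [UnitLaw, ← cancel_mono f, Category.assoc, ← h, ← whisker_exchange_assoc, a.unit, e]
    simp
  comp p m q := by
    -- All three blocks carry powers of f; `e1` and `e2` reassemble them into full tensor powers.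
    have k := insertOp_comp (h m).symm (p := p) (q := q) (tpowMap f p) (tpowMap f q)
    have e1 : tpowMap f (p + 1 + q) = (tsplit X (p + 1) q).hom ≫
        ((tpowMap f p ⊗ₘ f) ⊗ₘ tpowMap f q) ≫ (tsplit Y (p + 1) q).inv := by
      rw [← Category.assoc, Iso.eq_comp_inv, tpowMap_tsplit]
      rfl
    have e2 : (tsplit X (p + m) q).hom ≫ ((tsplit X p m).hom ▷ tpow X q) ≫
        ((tpowMap f p ⊗ₘ tpowMap f m) ⊗ₘ tpowMap f q) ≫ ((tsplit Y p m).inv ▷ tpow Y q) ≫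
          (tsplit Y (p + m) q).inv = tpowMap f (p + m + q) := by
      rw [← cancel_mono (tsplit Y (p + m) q).hom, tpowMap_tsplit]
      simp only [Category.assoc, Iso.inv_hom_id, Category.comp_id]
      congr 1
      rw [← reassoc_of% tensorHom_whiskerRight_comm (tpowMap_tsplit f p m) (tpowMap f q),
        hom_inv_whiskerRight, Category.comp_id]
    rw [← e1, e2] at k
    rw [← cancel_mono f, Category.assoc, ← h, ← whisker_exchange_assoc, a.comp]
    simp only [Category.assoc]
    rw [← h, ← whiskerLeft_comp_assoc, k, MonoidalCategory.whiskerLeft_comp_assoc,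
      associator_naturality_right_assoc]
  equivariant e := by
    rw [← cancel_mono f, Category.assoc, ← h, ← whisker_exchange_assoc, a.equivariant,
      ← whiskerLeft_comp_assoc, tpowMap_tperm, MonoidalCategory.whiskerLeft_comp_assoc, h,
      Category.assoc]

end Restriction

/-! ### Projections of the folding map and its vanishing on kernels. -/

section FoldTarget

variable {A : Type u} [Category.{v} A] [Abelian A] [MonoidalCategory A] [MonoidalPreadditive A]
  {X B : A}

/-- Every summand keeps one factor in X, which the projection to B kills. -/
theorem leadSum_snd (d : X ⟶ B) : ∀ n : ℕ, leadSum d n ≫ tpowMap biprod.snd n = 0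
  | 0 => by rw [leadSum_zero, zero_comp]
  | n + 1 => by
    have e : tpowMap (biprod.snd : X ⊞ B ⟶ B) (n + 1) = tpowMap biprod.snd n ⊗ₘ biprod.snd := rfl
    rw [leadSum_succ, e, Preadditive.add_comp, tensorHom_comp_tensorHom, tensorHom_comp_tensorHom,
      leadSum_snd d n, Category.assoc biprod.fst, biprod.inl_snd, comp_zero, MonoidalPreadditive.tensor_zero,
      MonoidalPreadditive.zero_tensor, add_zero]

theorem leadSum_cpowPrj_zero (d : X ⟶ B) (n : ℕ) : leadSum d n ≫ cpowPrj X B n 0 = 0 := by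
  apply cpow_hom_ext
  rintro ⟨w, hw⟩
  obtain rfl := eq_zero_of_sum_eq_zero hw
  rw [Category.assoc, cpowPrj_π, zero_comp]
  exact leadSum_snd d n

theorem fold_one (d : X ⟶ B) : fold d 1 = 𝟙 _ := by
  have e : tpowMap (baseProj X B) 0 = 𝟙 _ := rfl
  rw [fold_succ, fold_zero, e, ← MonoidalPreadditive.tensor_add, add_sub_cancel, id_tensorHom_id]

theorem fold_wordPrj (d : X ⟶ B) {n : ℕ} (w' : Fin n → Fin 2) :
    fold d n ≫ wordPrj X B w' =
      ∑ w : Fin n → Fin 2, if lead w = w' then wordPrj X B w ≫ wordStep d w w' else 0 := by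
  rw [fold, Preadditive.sum_comp]
  refine Finset.sum_congr rfl fun w _ => ?_
  rw [tmap_cell]
  split_ifs with h
  · subst h
    rw [Category.assoc, Category.assoc, wordInc_wordPrj_self, Category.comp_id]
  · rw [Category.assoc, Category.assoc, wordInc_wordPrj_of_ne h, comp_zero, comp_zero]

theorem wordInc_fold (d : X ⟶ B) {n : ℕ} (w : Fin n → Fin 2) :
    wordInc X B w ≫ fold d n = wordStep d w (lead w) ≫ wordInc X B (lead w) := by
  rw [fold, Preadditive.comp_sum, Fintype.sum_eq_single w]
  · rw [tmap_cell, ← Category.assoc, wordInc_wordPrj_self, Category.id_comp]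
  · intro w' hw'
    rw [tmap_cell, ← Category.assoc, wordInc_wordPrj_of_ne hw'.symm, zero_comp]

theorem fold_cpowPrj_one (d : X ⟶ B) (n : ℕ) :
    fold d n ≫ cpowPrj X B n 1 = partialMap d n ≫ biprod.fst := by
  apply cpow_hom_ext
  intro w'
  rw [Category.assoc, cpowPrj_π, fold_wordPrj]
  refine (biproduct.lift_π (fun w' : Words n 1 => ∑ w : Fin n → Fin 2,
    if lead w = w'.1 then wordPrj X B w ≫ wordStep d w w'.1 else 0) w').symm.trans ?_
  exact congrArg (· ≫ cpowπ X B w') (biprod.lift_fst _ _).symm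

theorem fold_cpowPrj_zero (d : X ⟶ B) (n : ℕ) :
    fold d n ≫ cpowPrj X B n 0 = partialMap d n ≫ biprod.snd := by
  apply cpow_hom_ext
  intro w'
  rw [Category.assoc, cpowPrj_π, fold_wordPrj]
  refine (biproduct.lift_π (fun w' : Words n 0 => ∑ w : Fin n → Fin 2,
    if lead w = w'.1 then wordPrj X B w ≫ wordStep d w w'.1 else 0) w').symm.trans ?_
  exact congrArg (· ≫ cpowπ X B w') (biprod.lift_snd _ _).symm

/-- The heart of the Cat¹ condition. If the leftmost X is the first factor, `target` hits the
second; otherwise `baseProj` hits the first. -/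
theorem tmap_leadSum_eq_zero (d : X ⟶ B) : ∀ {n : ℕ} {Y : Fin (n + 2) → A}
    (f : ∀ j, Y j ⟶ X ⊞ B), f 0 ≫ baseProj X B = 0 → f 1 ≫ target d = 0 →
    tmap f ≫ leadSum d (n + 2) = 0
  | n, Y, f, h0, h1 => by
    have hP (m : ℕ) (Y : Fin (m + 1) → A) (f : ∀ j, Y j ⟶ X ⊞ B) (h : f 0 ≫ baseProj X B = 0) :
        tmap f ≫ tpowMap (baseProj X B) (m + 1) = 0 := by
      rw [tmap_comp]
      exact tmap_eq_zero _ 0 h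
    rw [leadSum_succ, tmap, Preadditive.comp_add, tensorHom_comp_tensorHom,
      tensorHom_comp_tensorHom, hP _ _ (fun i => f i.castSucc) h0, MonoidalPreadditive.zero_tensor, add_zero]
    -- With two factors in all, the last one is the second, which `target` kills; with more, the
    -- vanishing passes to the first n + 2 of them.
    cases n with
    | zero =>
      have e : f (Fin.last (0 + 1)) ≫ target d = 0 := h1
      rw [e, MonoidalPreadditive.tensor_zero]
    | succ n =>
      rw [tmap_leadSum_eq_zero d (fun j => f j.castSucc) h0 h1, MonoidalPreadditive.zero_tensor]

end FoldTarget

/-! ### The algebra structure on V₁ ⊕ V₀ and the Cat¹ condition. -/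

section TotalAlgebra

variable {A : Type u} [Category.{v} A] [Abelian A] [MonoidalCategory A] [MonoidalPreadditive A]
  [SymmetricCategory A] {P : Operad A} {V₁ V₀ : A} {d : V₁ ⟶ V₀} (S : ComplexAlg P d)

namespace ComplexAlg

theorem baseProj_total (n : ℕ) : (P.obj n ◁ tpowMap (baseProj V₁ V₀) n) ≫ S.total n =
    (P.obj n ◁ tpowMap biprod.snd n) ≫ S.base n ≫ biprod.inr := by
  have e : tpowMap (baseProj V₁ V₀) n = tpowMap biprod.snd n ≫ tpowMap biprod.inr n :=
    (tmap_comp _ _).symm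
  rw [e, MonoidalCategory.whiskerLeft_comp_assoc, S.inr_total]

theorem leadSum_total_snd (n : ℕ) :
    (P.obj n ◁ leadSum d n) ≫ S.total n ≫ biprod.snd = 0 := by
  rw [totalMap_snd, ← whiskerLeft_comp_assoc, leadSum_cpowPrj_zero,
    MonoidalPreadditive.whiskerLeft_zero, zero_comp]

/-- The operations of the algebra on the total object `V₁ ⊕ V₀`. -/
def op (n : ℕ) : P.obj n ⊗ tpow (V₁ ⊞ V₀) n ⟶ V₁ ⊞ V₀ := (P.obj n ◁ fold d n) ≫ S.total n

theorem op_eq (n : ℕ) : S.op n = (P.obj n ◁ leadSum d n) ≫ S.total n +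
    (P.obj n ◁ tpowMap biprod.snd n) ≫ S.base n ≫ biprod.inr := by
  rw [← S.baseProj_total, ← Preadditive.add_comp, ← MonoidalPreadditive.whiskerLeft_add, ← fold_eq]
  rfl

theorem op_snd (n : ℕ) :
    S.op n ≫ biprod.snd = (P.obj n ◁ tpowMap biprod.snd n) ≫ S.base n := by
  rw [op_eq, Preadditive.add_comp, Category.assoc, leadSum_total_snd, zero_add]
  simp

theorem op_baseProj (n : ℕ) : S.op n ≫ baseProj V₁ V₀ =
    (P.obj n ◁ tpowMap (baseProj V₁ V₀) n) ≫ S.total n := by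
  rw [baseProj_total, ← Category.assoc, op_snd, Category.assoc]

theorem op_fst_inl (n : ℕ) : S.op n ≫ biprod.fst ≫ biprod.inl =
    (P.obj n ◁ leadSum d n) ≫ S.total n := by
  apply biprod.hom_ext
  · rw [op_eq]
    simp
  · rw [Category.assoc (P.obj n ◁ _), leadSum_total_snd]
    simp

/-- By `linear_comp`, applying d to the output is applying it to the one letter that folding spared.
All letters V₁ then have d applied, and the sum over words is a power of `target`. -/
theorem op_target (n : ℕ) : S.op n ≫ target d = (P.obj n ◁ tpowMap (target d) n) ≫ S.total n := by
  rw [op, fold, tpowMap_target, whiskerLeft_sum, whiskerLeft_sum, Preadditive.sum_comp,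
    Preadditive.sum_comp, Preadditive.sum_comp]
  refine Finset.sum_congr rfl fun w _ => ?_
  have e : tmap (fun j => cell d (w j) 0) = wordPrj V₁ V₀ w ≫ wordStep d w 0 ≫ wordInc V₁ V₀ 0 :=
    tmap_cell d w 0
  rw [e, tmap_cell]
  simp only [MonoidalCategory.whiskerLeft_comp, Category.assoc]
  congr 1
  rw [S.wordInc_zero_total]
  by_cases hw : w = 0
  · subst hw
    rw [lead_zero, reassoc_of% S.wordInc_zero_total]
    simp
  · obtain ⟨k, hk, h⟩ := exists_lead_eq_single hw
    rw [h, reassoc_of% S.wordInc_total, biprod.inl_desc_assoc, reassoc_of% S.linear_comp,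
      ← whiskerLeft_comp_assoc, wordStep_comp d]
    · intro j
      by_cases hj : j = k
      · rw [hj, hk, single_self]
      · rw [single_of_ne hj]
        exact Fin.zero_le _
    · intro j
      exact Fin.zero_le _

/-- Permuting a word can change its leftmost `1`, so folding is not equivariant; `tmap_cell_total`
shows that `total` does not see which `1` is spared. -/
theorem op_equivariant {n m : ℕ} (e : Fin n ≃ Fin m) :
    (P.act e ▷ tpow (V₁ ⊞ V₀) n) ≫ S.op n = (P.obj m ◁ tperm (V₁ ⊞ V₀) e) ≫ S.op m := by
  rw [op, op, ← whisker_exchange_assoc, S.total_equivariant, fold, fold, whiskerLeft_sum,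
    whiskerLeft_sum, Preadditive.sum_comp, Preadditive.sum_comp, Preadditive.comp_sum]
  -- Match the summand of w with that of the permuted word w ∘ e⁻¹.
  refine Fintype.sum_equiv (e.arrowCongr (Equiv.refl (Fin 2))) _ _ fun w => ?_
  have h := tmap_tperm e (fun j => cell d (w j) (lead w j))
    (fun j => cell d (w (e.symm j)) (lead w (e.symm j))) (fun j => by simp)
  rw [← whiskerLeft_comp_assoc, h, MonoidalCategory.whiskerLeft_comp_assoc]
  congr 1
  have e1 : ((e.arrowCongr (Equiv.refl (Fin 2))) w) = fun j => w (e.symm j) := rfl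
  rw [e1]
  by_cases hw : w = 0
  · subst hw
    have e2 : lead (fun j => (0 : Fin n → Fin 2) (e.symm j)) = 0 := lead_zero
    rw [lead_zero, e2]
    rfl
  · obtain ⟨k, hk, hl⟩ := exists_lead_eq_single hw
    obtain ⟨k', hk', hl'⟩ := exists_lead_eq_single (w := fun j => w (e.symm j)) (by
      intro h
      have := congrFun h (e k)
      simp [hk] at this)
    have e3 : (fun j => cell d (w (e.symm j)) (lead w (e.symm j))) =
        fun j => cell d (w (e.symm j)) (single (e k) j) := by
      funext j
      rw [hl]
      congr 1
      simp [single, Equiv.symm_apply_eq]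
    rw [e3, hl']
    exact S.tmap_cell_total (w := fun j => w (e.symm j)) (by simp [hk]) hk'

/-- The algebra structure on the total object `V₁ ⊕ V₀`. -/
def totalAlg : Alg P (V₁ ⊞ V₀) where
  μ := S.op
  unit := by
    rw [UnitLaw, op, fold_one, MonoidalCategory.whiskerLeft_id, Category.id_comp]
    exact S.unit
  comp p m q := by
    -- This moves the folding to the inputs of the composite and turns the inner `op` into `total`,
    -- whose composition law is given.
    have k := insertOp_fold d (S.op_target m) (S.op_fst_inl m) (S.op_baseProj m) p q
    have e : (P.circ p m q ▷ tpow (V₁ ⊞ V₀) (p + m + q)) ≫ S.total (p + m + q) =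
        (α_ _ _ _).hom ≫ (P.obj (p + 1 + q) ◁ insertOp (S.total m) p q) ≫ S.total (p + 1 + q) :=
      S.comp p m q
    change (P.circ p m q ▷ _) ≫ (_ ◁ fold d _) ≫ S.total _ =
      _ ≫ _ ≫ (_ ◁ fold d _) ≫ S.total _
    rw [← whisker_exchange_assoc, ← whiskerLeft_comp_assoc, k,
      MonoidalCategory.whiskerLeft_comp_assoc, ← associator_naturality_right_assoc, e]
  equivariant := S.op_equivariant

theorem inr_op (n : ℕ) :
    (P.obj n ◁ tpowMap biprod.inr n) ≫ S.op n = S.base n ≫ biprod.inr := by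
  have e : wordInc V₁ V₀ (0 : Fin n → Fin 2) ≫ fold d n = wordInc V₁ V₀ (0 : Fin n → Fin 2) := by
    rw [wordInc_fold, lead_zero, wordStep_self, Category.id_comp]
  rw [op, ← whiskerLeft_comp_assoc]
  exact (congrArg (fun f => (P.obj n ◁ f) ≫ S.total n) e).trans (S.inr_total n)

/-- The algebra structure on the degree zero part. -/
def baseAlg : Alg P V₀ := S.totalAlg.restrict biprod.inr S.base S.inr_op

theorem isAlgHom_snd : IsAlgHom S.totalAlg S.baseAlg biprod.snd := fun n => (S.op_snd n).symm

theorem isAlgHom_inr : IsAlgHom S.baseAlg S.totalAlg biprod.inr := S.inr_op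

theorem isAlgHom_target : IsAlgHom S.totalAlg S.baseAlg (biprod.desc d (𝟙 V₀)) := by
  intro n
  have e : tpowMap (target d) n = tpowMap (biprod.desc d (𝟙 V₀)) n ≫ tpowMap biprod.inr n :=
    (tmap_comp _ _).symm
  have h := S.op_target n
  rw [e, MonoidalCategory.whiskerLeft_comp_assoc, S.inr_total, ← Category.assoc,
    ← Category.assoc, cancel_mono] at h
  exact h.symm

theorem isCat1 : IsCat1 S.totalAlg S.baseAlg biprod.snd (biprod.desc d (𝟙 V₀)) biprod.inr where
  hom_s := S.isAlgHom_snd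
  hom_t := S.isAlgHom_target
  hom_i := S.isAlgHom_inr
  i_s := biprod.inr_snd
  i_t := biprod.inr_desc _ _
  cat1 n := by
    have h0 : kerInc (biprod.snd : V₁ ⊞ V₀ ⟶ V₀) (biprod.desc d (𝟙 V₀)) n 0 ≫ biprod.snd = 0 :=
      kernel.condition _
    have h1 : kerInc (biprod.snd : V₁ ⊞ V₀ ⟶ V₀) (biprod.desc d (𝟙 V₀)) n 1 ≫
        biprod.desc d (𝟙 V₀) = 0 := kernel.condition _
    -- Folding alone already vanishes here: the summand of degree zero dies on the factor ker s, the
    -- others by `tmap_leadSum_eq_zero`.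
    have e : tmap (kerInc (biprod.snd : V₁ ⊞ V₀ ⟶ V₀) (biprod.desc d (𝟙 V₀)) n) ≫
        fold d (n + 2) = 0 := by
      rw [fold_eq, Preadditive.comp_add, tmap_leadSum_eq_zero, zero_add, tmap_comp,
        tmap_eq_zero _ 0]
      · rw [reassoc_of% h0, zero_comp]
      · rw [reassoc_of% h0, zero_comp]
      · rw [reassoc_of% h1, zero_comp]
    change _ ≫ (P.obj (n + 2) ◁ fold d (n + 2)) ≫ S.total (n + 2) = 0
    rw [← whiskerLeft_comp_assoc, e, MonoidalPreadditive.whiskerLeft_zero, zero_comp]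

end ComplexAlg

end TotalAlgebra

/-! ### Relative tensor powers, coinvariants and morphisms out of P ∘ (B | X). -/

section RelativePowers

variable {A : Type u} [Category.{v} A] [Abelian A] [MonoidalCategory A]

/-- The section of the projection `(X ⊕ B)^{⊗ n} ⟶ (X ⊕ B)^{⊗ n} / B^{⊗ n}` that vanishes on
`B^{⊗ n}` under the projection `X ⊕ B ⟶ B`. -/
def relSec (X B : A) (n : ℕ) : relPow X B n ⟶ tpow (X ⊞ B) n :=
  cokernel.desc _ (𝟙 _ - tpowMap biprod.snd n ≫ tpowMap biprod.inr n) (by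
    have e : tpowMap (biprod.inr : B ⟶ X ⊞ B) n ≫ tpowMap biprod.snd n = 𝟙 _ := by
      rw [tmap_comp]
      simp only [biprod.inr_snd, tmap_id]
    rw [Preadditive.comp_sub, reassoc_of% e, Category.comp_id, sub_self])

/-- The projection `(X ⊕ B)^{⊗ n} ⟶ (X ⊕ B)^{⊗ n} / B^{⊗ n}`. -/
def relProj (X B : A) (n : ℕ) : tpow (X ⊞ B) n ⟶ relPow X B n :=
  cokernel.π (tpowMap (biprod.inr : B ⟶ X ⊞ B) n)

instance (X B : A) (n : ℕ) : Epi (relProj X B n) :=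
  inferInstanceAs (Epi (cokernel.π (tpowMap (biprod.inr : B ⟶ X ⊞ B) n)))

theorem inr_relProj (X B : A) (n : ℕ) : tpowMap biprod.inr n ≫ relProj X B n = 0 :=
  cokernel.condition _

theorem relProj_relSec (X B : A) (n : ℕ) : relProj X B n ≫ relSec X B n =
    𝟙 _ - tpowMap biprod.snd n ≫ tpowMap biprod.inr n :=
  cokernel.π_desc _ _ _

theorem relSec_relProj (X B : A) (n : ℕ) : relSec X B n ≫ relProj X B n = 𝟙 (relPow X B n) := by
  rw [← cancel_epi (relProj X B n), ← Category.assoc, relProj_relSec, Preadditive.sub_comp,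
    Category.assoc, inr_relProj, comp_zero, sub_zero, Category.id_comp, Category.comp_id]

variable [SymmetricCategory A]

theorem relProj_relPerm (X B : A) {n : ℕ} (e : Equiv.Perm (Fin n)) :
    relProj X B n ≫ relPerm X B e = tperm (X ⊞ B) e ≫ relProj X B n :=
  cokernel.π_desc _ _ _

/-- A splitting survives tensoring, so morphisms out of Z ⊗ `relPow` can be compared on Z ⊗ (X ⊕
B)^{⊗ n} without any exactness of the tensor product. -/
instance (Z X B : A) (n : ℕ) : IsSplitEpi (Z ◁ relProj X B n) :=
  ⟨⟨⟨Z ◁ relSec X B n, by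
    rw [← MonoidalCategory.whiskerLeft_comp, relSec_relProj, MonoidalCategory.whiskerLeft_id]⟩⟩⟩

/-- The projection on the coinvariants. -/
def relCoinv.of (P : Operad A) (X B : A) (n : ℕ) : P.obj n ⊗ relPow X B n ⟶ relCoinv P X B n :=
  cokernel.π _

/-- The inclusion of a summand of `P ∘ (B | X)`. -/
def relSchur.ι [HasColimits A] (P : Operad A) (X B : A) (n : ℕ) :
    relCoinv P X B n ⟶ relSchur P X B :=
  Limits.Sigma.ι (relCoinv P X B) n

theorem relSchur.of_eq [HasColimits A] (P : Operad A) (X B : A) (n : ℕ) : relSchur.of P X B n =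
    (P.obj n ◁ relProj X B n) ≫ relCoinv.of P X B n ≫ relSchur.ι P X B n :=
  rfl

/-- The morphism on coinvariants defined by an invariant morphism. -/
def relCoinv.desc {P : Operad A} {X B Y : A} {n : ℕ} (f : P.obj n ⊗ relPow X B n ⟶ Y)
    (h : ∀ e : Equiv.Perm (Fin n), (P.act e ▷ relPow X B n) ≫ f = (P.obj n ◁ relPerm X B e) ≫ f) :
    relCoinv P X B n ⟶ Y :=
  cokernel.desc _ f (by
    apply biproduct.hom_ext'
    intro e
    rw [biproduct.ι_desc_assoc, comp_zero, Preadditive.sub_comp, sub_eq_zero, h])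

theorem relCoinv.of_desc {P : Operad A} {X B Y : A} {n : ℕ} (f : P.obj n ⊗ relPow X B n ⟶ Y)
    (h : ∀ e : Equiv.Perm (Fin n), (P.act e ▷ relPow X B n) ≫ f = (P.obj n ◁ relPerm X B e) ≫ f) :
    relCoinv.of P X B n ≫ relCoinv.desc f h = f :=
  cokernel.π_desc _ _ _

variable [MonoidalPreadditive A] {P : Operad A} {X B : A}
  (r : ∀ n, P.obj n ⊗ tpow (X ⊞ B) n ⟶ X)

/-- The idempotent `relProj` ≫ `relSec` differs from the identity by a map through B^{⊗ n}, where r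
vanishes; so `relSec` followed by r is the induced map on the quotient. -/
theorem whiskerLeft_relProj_relSec (h : ∀ n, (P.obj n ◁ tpowMap biprod.inr n) ≫ r n = 0) (n : ℕ) :
    (P.obj n ◁ relProj X B n) ≫ (P.obj n ◁ relSec X B n) ≫ r n = r n := by
  rw [← whiskerLeft_comp_assoc, relProj_relSec, whiskerLeft_sub, Preadditive.sub_comp,
    MonoidalCategory.whiskerLeft_comp_assoc, h, comp_zero, sub_zero,
    MonoidalCategory.whiskerLeft_id, Category.id_comp]

theorem relSec_invariant (h : ∀ n, (P.obj n ◁ tpowMap biprod.inr n) ≫ r n = 0)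
    (he : ∀ (n : ℕ) (e : Equiv.Perm (Fin n)),
      (P.act e ▷ tpow (X ⊞ B) n) ≫ r n = (P.obj n ◁ tperm (X ⊞ B) e) ≫ r n)
    (n : ℕ) (e : Equiv.Perm (Fin n)) :
    (P.act e ▷ relPow X B n) ≫ (P.obj n ◁ relSec X B n) ≫ r n =
      (P.obj n ◁ relPerm X B e) ≫ (P.obj n ◁ relSec X B n) ≫ r n := by
  have k := whiskerLeft_relProj_relSec r h n
  rw [← cancel_epi (P.obj n ◁ relProj X B n), whisker_exchange_assoc, k, ← whiskerLeft_comp_assoc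
    (P.obj n) (relProj X B n), relProj_relPerm, MonoidalCategory.whiskerLeft_comp_assoc, k, he]

/-- The morphism `P ∘ (B | X) ⟶ X` defined by equivariant morphisms on `P(n) ⊗ (X ⊕ B)^{⊗ n}` that
vanish on `P(n) ⊗ B^{⊗ n}`. -/
def relSchur.desc [HasColimits A] (h : ∀ n, (P.obj n ◁ tpowMap biprod.inr n) ≫ r n = 0)
    (he : ∀ (n : ℕ) (e : Equiv.Perm (Fin n)),
      (P.act e ▷ tpow (X ⊞ B) n) ≫ r n = (P.obj n ◁ tperm (X ⊞ B) e) ≫ r n) :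
    relSchur P X B ⟶ X :=
  Limits.Sigma.desc fun n => relCoinv.desc _ (relSec_invariant r h he n)

theorem relSchur.of_desc [HasColimits A] (h : ∀ n, (P.obj n ◁ tpowMap biprod.inr n) ≫ r n = 0)
    (he : ∀ (n : ℕ) (e : Equiv.Perm (Fin n)),
      (P.act e ▷ tpow (X ⊞ B) n) ≫ r n = (P.obj n ◁ tperm (X ⊞ B) e) ≫ r n) (n : ℕ) :
    relSchur.of P X B n ≫ relSchur.desc r h he = r n := by
  have h1 : relSchur.ι P X B n ≫ relSchur.desc r h he =
      relCoinv.desc _ (relSec_invariant r h he n) := Limits.Sigma.ι_desc _ _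
  rw [relSchur.of_eq, Category.assoc, Category.assoc, h1, relCoinv.of_desc,
    whiskerLeft_relProj_relSec r h n]

end RelativePowers

theorem eq_zero_of_isZero_left {A : Type u} [Category.{v} A] [Abelian A] [MonoidalCategory A]
    [MonoidalPreadditive A] {X Y Z : A} (h : IsZero X) (f : X ⊗ Y ⟶ Z) : f = 0 := by
  rw [← Category.id_comp f, ← id_whiskerRight, h.eq_of_src (𝟙 X) 0,
    MonoidalPreadditive.zero_whiskerRight, zero_comp]

/-! ### The algebra V₁, the action of V₀ and the crossed module. -/

section CrossedModules

variable {A : Type u} [Category.{v} A] [Abelian A] [MonoidalCategory A] [MonoidalPreadditive A]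
  [SymmetricCategory A] {P : Operad A} {V₁ V₀ : A} {d : V₁ ⟶ V₀} (S : ComplexAlg P d)

namespace ComplexAlg

/-- V₁ is the kernel of the morphism s, hence closed under operations with at least one argument. An
operation without arguments could leave it, which P(0) = 0 excludes. -/
theorem inl_op (hP : IsZero (P.obj 0)) (n : ℕ) : (P.obj n ◁ tpowMap biprod.inl n) ≫ S.op n =
    ((P.obj n ◁ tpowMap biprod.inl n) ≫ S.op n ≫ biprod.fst) ≫ biprod.inl := by
  cases n with
  | zero => rw [eq_zero_of_isZero_left hP (S.op 0), zero_comp, comp_zero, comp_zero, zero_comp]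
  | succ n =>
    apply biprod.hom_ext
    · simp
    · rw [Category.assoc, op_snd, ← whiskerLeft_comp_assoc, tmap_comp,
        tmap_eq_zero _ 0 biprod.inl_snd, MonoidalPreadditive.whiskerLeft_zero, zero_comp]
      simp

/-- The algebra structure on the degree one part. -/
def topAlg (hP : IsZero (P.obj 0)) : Alg P V₁ :=
  S.totalAlg.restrict biprod.inl (fun n => (P.obj n ◁ tpowMap biprod.inl n) ≫ S.op n ≫ biprod.fst)
    (S.inl_op hP)

theorem isAlgHom_inl (hP : IsZero (P.obj 0)) : IsAlgHom (S.topAlg hP) S.totalAlg biprod.inl :=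
  S.inl_op hP

theorem inr_op_fst (n : ℕ) : (P.obj n ◁ tpowMap biprod.inr n) ≫ S.op n ≫ biprod.fst = 0 := by
  rw [← Category.assoc, inr_op, Category.assoc, biprod.inr_fst, comp_zero]

theorem op_fst_equivariant (n : ℕ) (e : Equiv.Perm (Fin n)) :
    (P.act e ▷ tpow (V₁ ⊞ V₀) n) ≫ S.op n ≫ biprod.fst =
      (P.obj n ◁ tperm (V₁ ⊞ V₀) e) ≫ S.op n ≫ biprod.fst := by
  rw [← Category.assoc, op_equivariant, Category.assoc]

theorem wordInc_op_snd {n : ℕ} {w : Fin n → Fin 2} (hw : ∃ k, w k = 1) :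
    (P.obj n ◁ wordInc V₁ V₀ w) ≫ S.op n ≫ biprod.snd = 0 := by
  obtain ⟨k, hk⟩ := hw
  have h {c : Fin 2} (hc : c = 1) : inc V₁ V₀ c ≫ biprod.snd = 0 := by
    subst hc
    exact biprod.inl_snd
  rw [op_snd, ← whiskerLeft_comp_assoc, tmap_comp, tmap_eq_zero _ k (h hk),
    MonoidalPreadditive.whiskerLeft_zero, zero_comp]

variable [HasColimits A]

/-- The action of the degree zero part on the degree one part. -/
def action (hP : IsZero (P.obj 0)) : Action (S.topAlg hP) S.baseAlg where
  ρ := relSchur.desc _ S.inr_op_fst S.op_fst_equivariant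
  restrict n := by
    rw [relSchur.of_desc]
    rfl
  assoc p m q := by
    -- The action and the operations of V₀ together recover `op`, so associativity is the
    -- V₁-component of the composition law on V₁ ⊕ V₀.
    have h : semidirectMap S.baseAlg m (S.op m ≫ biprod.fst) = S.op m := by
      apply biprod.hom_ext
      · exact biprod.lift_fst _ _
      · exact (biprod.lift_snd _ _).trans (S.op_snd m).symm
    rw [relSchur.of_desc, relSchur.of_desc, relSchur.of_desc, h, ← Category.assoc]
    have k := S.totalAlg.comp p m q
    exact (congrArg (· ≫ biprod.fst) k).trans (by simp only [Category.assoc]; rfl)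

theorem action_on (hP : IsZero (P.obj 0)) {n : ℕ} (w : Fin n → Fin 2) :
    (S.action hP).on w = (P.obj n ◁ wordInc V₁ V₀ w) ≫ S.op n ≫ biprod.fst :=
  congrArg (fun f => (P.obj n ◁ wordInc V₁ V₀ w) ≫ f) (relSchur.of_desc _ S.inr_op_fst S.op_fst_equivariant n)

theorem action_on_inl (hP : IsZero (P.obj 0)) {n : ℕ} {w : Fin n → Fin 2} (hw : ∃ k, w k = 1) :
    (S.action hP).on w ≫ biprod.inl = (P.obj n ◁ wordInc V₁ V₀ w) ≫ S.op n := by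
  apply biprod.hom_ext
  · rw [action_on]
    simp
  · rw [Category.assoc (P.obj n ◁ _), S.wordInc_op_snd hw]
    simp

theorem action_isInducedBy (hP : IsZero (P.obj 0)) :
    (S.action hP).IsInducedBy S.totalAlg biprod.inl biprod.inr := by
  intro n w hw
  have e : biprod.desc biprod.inl biprod.inr = 𝟙 (V₁ ⊞ V₀) := by
    apply biprod.hom_ext' <;> simp
  rw [S.action_on_inl hP hw, e, tpowMap, tmap_id, Category.comp_id]
  rfl

/-- As d is t restricted to V₁, the morphism property and equivariance both come from t being a
morphism of algebras. -/
theorem isCrossedModule (hP : IsZero (P.obj 0)) : IsCrossedModule (S.action hP) d where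
  hom n := by
    have h := S.isAlgHom_target n
    have e : tpowMap d n = tpowMap (biprod.inl : V₁ ⟶ V₁ ⊞ V₀) n ≫
        tpowMap (biprod.desc d (𝟙 V₀)) n := by
      rw [tmap_comp]
      simp only [biprod.inl_desc]
    rw [e, MonoidalCategory.whiskerLeft_comp_assoc, h, ← Category.assoc, S.isAlgHom_inl hP,
      Category.assoc, biprod.inl_desc]
  equivariant n w hw := by
    have h := S.isAlgHom_target n
    have e := congrArg (· ≫ biprod.desc d (𝟙 V₀)) (S.action_on_inl hP hw)
    simp only [Category.assoc, biprod.inl_desc] at e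
    rw [MonoidalCategory.whiskerLeft_comp_assoc, h, e]
    rfl
  peiffer n i h2 hi := by
    have h0 : (0 : ℕ) < n := by omega
    -- All these words have their leftmost `1` at place 0, so they fold to the same word; both sides
    -- of the Peiffer identity are then instances of `key`.
    have hl {i : ℕ} (hi : 1 ≤ i) : lead (initialWord n i) = initialWord n 1 := by
      rw [lead_eq_single (k := ⟨0, h0⟩)]
      · funext j
        simp [single, initialWord, Fin.ext_iff]
      · exact if_pos hi
      · intro j hj
        exact absurd hj (Nat.not_lt_zero _)
    have key {i : ℕ} (hi : 1 ≤ i) : (S.action hP).on (initialWord n i) =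
        (P.obj n ◁ wordStep d (initialWord n i) (initialWord n 1)) ≫
          (P.obj n ◁ wordInc V₁ V₀ (initialWord n 1)) ≫ S.total n ≫ biprod.fst := by
      rw [action_on, op, Category.assoc, ← whiskerLeft_comp_assoc, wordInc_fold, hl hi,
        MonoidalCategory.whiskerLeft_comp_assoc]
    rw [key (by omega), key le_rfl, wordStep_self, MonoidalCategory.whiskerLeft_id,
      Category.id_comp]

end ComplexAlg

end CrossedModules

/-! ### Comparison with the map ⋊ on internal Homs. -/

section InternalHom

variable {A : Type u} [Category.{v} A] [Abelian A] [MonoidalCategory A] [MonoidalPreadditive A]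
  [MonoidalClosed A]

theorem curry_add {X Y Z : A} (f g : X ⊗ Y ⟶ Z) :
    MonoidalClosed.curry (f + g) = MonoidalClosed.curry f + MonoidalClosed.curry g := by
  apply MonoidalClosed.uncurry_injective
  rw [MonoidalClosed.uncurry_curry, MonoidalClosed.uncurry_eq, MonoidalPreadditive.whiskerLeft_add,
    Preadditive.add_comp, ← MonoidalClosed.uncurry_eq, ← MonoidalClosed.uncurry_eq,
    MonoidalClosed.uncurry_curry, MonoidalClosed.uncurry_curry]

variable [SymmetricCategory A] {P : Operad A} {V₁ V₀ : A} {d : V₁ ⟶ V₀} (S : ComplexAlg P d)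

/-- The two components of `fold` in degrees 1 and 0 are those of `partialMap`, so `op` is (μ₁ ⊕ μ₀)
∘ ∂; the rest is naturality and additivity of currying. -/
theorem ComplexAlg.toEnd_totalAlg (n : ℕ) : S.totalAlg.toEnd n = S.toEndA n ≫ rtimes d n := by
  have h : S.op n = (P.obj n ◁ partialMap d n) ≫ ((P.obj n ◁ biprod.fst) ≫ S.μ₁ n ≫ biprod.inl +
      (P.obj n ◁ biprod.snd) ≫ S.μ₀ n ≫ biprod.inr) := by
    rw [Preadditive.comp_add, ← whiskerLeft_comp_assoc, ← whiskerLeft_comp_assoc,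
      ← fold_cpowPrj_one, ← fold_cpowPrj_zero]
    apply biprod.hom_ext
    · rw [op, Category.assoc, totalMap_fst]
      simp
    · rw [op, Category.assoc, totalMap_snd]
      simp
  have h1 : S.toEndA n ≫ EndA.ev d n =
      biprod.lift (MonoidalClosed.curry ((β_ (cpow V₁ V₀ n 1) (P.obj n)).hom ≫ S.μ₁ n))
        (MonoidalClosed.curry ((β_ (cpow V₁ V₀ n 0) (P.obj n)).hom ≫ S.μ₀ n)) :=
    kernel.lift_ι _ _ _
  have h2 : S.totalAlg.toEnd n =
      MonoidalClosed.curry ((β_ (tpow (V₁ ⊞ V₀) n) (P.obj n)).hom ≫ S.op n) := rfl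
  rw [rtimes, reassoc_of% h1, diagHom, biprod.lift_desc_assoc, MonoidalClosed.curry_pre_app_assoc,
    MonoidalClosed.curry_pre_app_assoc, ← MonoidalClosed.curry_natural_right,
    ← MonoidalClosed.curry_natural_right, ← curry_add, MonoidalClosed.curry_pre_app, h2, h]
  simp only [Preadditive.comp_add, Category.assoc, BraidedCategory.braiding_naturality_left_assoc]

end InternalHom

end OpAlg

end

theorem mainTheorem8 {A : Type u} [Category.{v} A] [Abelian A] [HasLimits A] [HasColimits A]
    [MonoidalCategory A] [SymmetricCategory A] [MonoidalClosed A]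
    (P : OpAlg.Operad A) (hP : P.IsReduced) {V₁ V₀ : A} (d : V₁ ⟶ V₀)
    (S : OpAlg.ComplexAlg P d) :
    ∃ (a : OpAlg.Alg P (V₁ ⊞ V₀)) (b : OpAlg.Alg P V₀),
      (∀ n, a.toEnd n = S.toEndA n ≫ OpAlg.rtimes d n) ∧
      (∀ n, b.μ n = S.base n) ∧
      OpAlg.IsCat1 a b biprod.snd (biprod.desc d (𝟙 V₀)) biprod.inr ∧
      ∃ (x : OpAlg.Alg P V₁) (r : OpAlg.Action x b),
        OpAlg.IsAlgHom x a biprod.inl ∧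
        r.IsInducedBy a biprod.inl biprod.inr ∧
        OpAlg.IsCrossedModule r d := by
  have := OpAlg.monoidalPreadditive_of_closed A
  exact ⟨S.totalAlg, S.baseAlg, S.toEnd_totalAlg, fun _ => rfl, S.isCat1, S.topAlg hP.1,
    S.action hP.1, S.isAlgHom_inl hP.1, S.action_isInducedBy hP.1, S.isCrossedModule hP.1⟩
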